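/- Fix positive integers $N,K$, a vector space $\mathcal V$ over a field $\mathcal F$, and a linear code with encoding maps $\Phi_i:\mathcal V^K\to\mathcal W_i$, $i=1,\dots,N$, together with re-encoding functions and, for every recovery set of an object (a set of servers whose symbols determine its value), a decoding function. Consider the CausalEC algorithm, described below, which stores the objects $X_1,\dots,X_K$ (initial value $0\in\mathcal V$) at $N$ servers by means of this code. Servers communicate over reliable asynchronous FIFO channels; each client has a distinct natural number as identifier and talks to one fixed server; operations have unique identifiers; nodes may halt; and each client has at most one pending operation at any time. **The algorithm.** Let $\mathcal X_s$ be the set of objects on which $\Phi_s$ depends, and $\Gamma_{s,X}(y,a,b)$ the re-encoding function, which turns the symbol $y\in\mathcal W_s$ of a data vector whose $X$-entry is $a$ into that of the vector with $X$-entry $b$. A tag is a pair $t=(t.ts,t.id)\in\mathbb N^N\times\mathbb N$; $t<t'$ means $t.ts<t'.ts$, or $t.ts\not>t'.ts$ and $t.id<t'.id$; and $t\le t'$ means $t<t'$ or $t=t'$. (If a set of tags below has no highest element, "highest" or "max" may be any of its elements.) Server $s$ keeps a vector clock $vc=0$, a set $InQueue=\emptyset$, for each object $X$ a list $L[X]=\{(0,0)\}$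 of tag-value pairs and a set $DelL[X]=\emptyset$ of tag-server pairs, a symbol $M.val=0\in\mathcal W_s$ with tags $M.tag[X]=0$, tags $tmax[X]=0$, and a set $ReadL=\emptyset$ of pending reads $(c,o,X,\tau,\bar w)$ with $c$ a client or "localhost", $o$ an operation identifier, $\tau$ a vector of tags and $\bar w\in\prod_i(\mathcal W_i\cup\{\bot\})$ (initial values as shown). A client sends its request to its server and completes its operation on receiving the response. The following steps of server $s$ are atomic; loops take the objects in any order. * *write$(o,X,v)$ from client $c$:* increase $vc[s]$ by 1, let $t=(vc,\mathrm{id}(c))$, add $(t,v)$ to $L[X]$, acknowledge, send $app(X,v,t)$ to all other servers, and return $v$ to all pending client reads of $X$, removing them from $ReadL$. * *read$(o,X)$ from client $c$:* if $L[X]\ne\emptyset$ and its highest tag is $\ge M.tag[X]$, return the value of the highest tagged entry; else if $\{s\}$ is a recovery set of $X$, return the value decoded from $M.val$; else add $(c,o,X,M.tag,\bar w)$ to $ReadL$, where $w_s=M.val$ and $w_i=\bot$ for $i\neq s$, and send $val\_inq(c,o,X,M.tag)$ to all other servers. * *$app(X,v,t)$ from $j$:* add $(j,X,v,t)$ to $InQueue$.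 *$del(X,t)$ from $j$:* add $(t,j)$ to $DelL[X]$. * *$val\_inq(c,o,X,\tau)$ from $j$:* if $(\tau[X],v)\in L[X]$ for some $v$, send $val\_resp(X,v,c,o,\tau)$ to $j$. Otherwise start with $R=M$; for each $Y\in\mathcal X_s$ with $M.tag[Y]\ne\tau[Y]$ for which there is a unique $a$ with $(M.tag[Y],a)\in L[Y]$, put $R.val\leftarrow\Gamma_{s,Y}(R.val,a,0)$, $R.tag[Y]\leftarrow 0$ and then, if there is a unique $b$ with $(\tau[Y],b)\in L[Y]$, $R.val\leftarrow\Gamma_{s,Y}(R.val,0,b)$, $R.tag[Y]\leftarrow\tau[Y]$; send $val\_resp\_encoded(R,c,o,X,\tau)$ to $j$. * *$val\_resp(X,v,c,o,\tau)$:* if there is an entry $(c,o,X,\tau,\bar w)\in ReadL$, remove it and return $v$ to $c$, or, if $c$ is localhost, add $(\tau[X],v)$ to $L[X]$. * *$val\_resp\_encoded(R,c,o,X,\tau)$ from $j$:* if there is an entry $(c,o,X,\tau,\bar w)\in ReadL$, start with $y=R.val$. For each $Y\in\mathcal X_j$ with $\tau[Y]\ne R.tag[Y]$: if $R.tag[Y]\neq0$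 and there is a unique $a$ with $(R.tag[Y],a)\in L[Y]$, put $y\leftarrow\Gamma_{j,Y}(y,a,0)$; if $R.tag[Y]\ne0$ and there is no unique such $a$, record an error; if there was no such error for $Y$ and there is a unique $b$ with $(\tau[Y],b)\in L[Y]$, put $y\leftarrow\Gamma_{j,Y}(y,0,b)$; otherwise record an error. If no error was recorded, set the $j$-th entry of $\bar w$ in $ReadL$ to $y$; if now the non-$\bot$ entries contain a recovery set of $X$, decode a value $v$ of $X$ from it, remove the entry from $ReadL$, and return $v$ to $c$, or, if $c$ is localhost, add $(M.tag[X],v)$ to $L[X]$. * *Apply (internal, if $InQueue\neq\emptyset$):* let $(j,X,v,t)$ be an element of $InQueue$ with minimal $t.ts$. If $t.ts[p]\le vc[p]$ for all $p\ne j$ and $t.ts[j]=vc[j]+1$, remove it from $InQueue$, put $vc[j]\leftarrow t.ts[j]$, add $(t,v)$ to $L[X]$, return $v$ to all pending client reads of $X$ with $\tau[X]\le t$, and remove these and all localhost reads of $X$ with $\tau[X]=t$ from $ReadL$. * *Encoding (internal):* first, for every $X\in\mathcal X_s$ with $L[X]\ne\emptyset$ whose highest tag $h$ in $L[X]$ is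 $>M.tag[X]$: if $(M.tag[X],a)\in L[X]$ for some $a$, take $b$ with $(h,b)\in L[X]$, put $M.val\leftarrow\Gamma_{s,X}(M.val,a,b)$, $M.tag[X]\leftarrow h$, add $(h,s)$ to $DelL[X]$, and send $del(X,h)$ to all other servers $i$ with $X\in\mathcal X_i$; otherwise, if there is no localhost read of $X$ in $ReadL$ with $\tau[X]=M.tag[X]$, add $(\text{localhost},o,X,M.tag,\bar w)$ with a fresh $o$ and $\bar w$ as for a read, and send $val\_inq(\text{localhost},o,X,M.tag)$ to all other servers. Then, for every $X\notin\mathcal X_s$ with $L[X]\neq\emptyset$ and highest tag $>M.tag[X]$: let $A$ be the set of tags $t>M.tag[X]$ in $L[X]$ such that for each $i$ with $X\in\mathcal X_i$ there is $(t',i)\in DelL[X]$ with $t'\ge t$; if $A\ne\emptyset$, put $M.tag[X]\leftarrow\max A$, add $(\max A,s)$ to $DelL[X]$, and send $del(X,\max A)$ to all other servers. * *Garbage collection (internal):* for every $X$, let $S$ be the set of tags $t$ such that for every server $i$ there is $(t',i)\in DelL[X]$ with $t'\ge t$; put $tmax[X]\leftarrow\max S$ (unchanged if $S=\emptyset$).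 Let $T$ be the set of tags $\tau[X]<M.tag[X]$ of the entries of $ReadL$. Remove from $L[X]$ the entries with tags $t\notin T$ and $t\le tmax[X]$ if either $tmax[X]=M.tag[X]$, $(M.tag[X],i)\in DelL[X]$ for all $i$, and $L[X]$ is empty or has highest tag $\le M.tag[X]$, or $tmax[X]<M.tag[X]$ and $X\notin\mathcal X_s$; in all other cases remove the entries with tags $t\notin T$ and $t<tmax[X]$. Finally, let $U$ be the set of tags $t$ such that for each $i$ with $X\in\mathcal X_i$ there is $(t',i)\in DelL[X]$ with $t'\ge t$; if $U\ne\emptyset$ and $X\in\mathcal X_s$, send $del(X,\max U)$ to all other servers. **The claim.** Let $\beta$ be any finite or infinite execution of the algorithm. The operations of $\beta$ are the reads and writes invoked by clients and, for every object, one initial write of the value $0$. For operations $\pi_1,\pi_2$ of the same client write $\pi_1\to\pi_2$ if $\pi_1$ is invoked before $\pi_2$. An invoked operation $\pi$ has a timestamp if the server of its client sends a response to it in $\beta$; the timestamp $ts(\pi)\in\mathbb N^N$ is then the vector clock of this server at the first such point. Initial writes have timestamp $0$. Vector clocks are compared componentwise. Define $\pi_1\leadsto\pi_2$ if one of the following holds: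 * both have timestamps and $ts(\pi_1)<ts(\pi_2)$; * both have timestamps, $ts(\pi_1)=ts(\pi_2)$, $\pi_1$ is a write and $\pi_2$ is a read; * both are reads with timestamps, $ts(\pi_1)=ts(\pi_2)$, and $\pi_1\to\pi_2$; * $\pi_1$ has a timestamp and $\pi_2$ has none. For a strict partial order $\prec$ on the operations and a completed read $\pi$ of an object $X$ that returns $v$, say that $\pi$ reads from a write $\phi$ with respect to $\prec$ if $\phi\prec\pi$, $\phi$ writes $v$ to $X$, and no write $\omega$ with $\phi\prec\omega\prec\pi$ writes $v$ to $X$. Call $\beta$ causally consistent if there is a strict partial order $\prec$ on its operations such that $\pi_1\to\pi_2$ implies $\pi_1\prec\pi_2$, and every completed read reads from a unique write with respect to $\prec$. Then $\beta$ is causally consistent. More precisely: 1. $\leadsto$ is a strict partial order on the operations of $\beta$; 2. $\pi_1\to\pi_2$ implies $\pi_1\leadsto\pi_2$; 3. every completed read reads from some write with respect to $\leadsto$; 4. there is a strict partial order $\prec$ that extends $\leadsto$ and shows that $\beta$ is causally consistent; in particular, every completed read reads from a unique write with respect to $\prec$. -/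

import Mathlib

/-!
The CausalEC protocol as a transition system: clients, servers, reliable channels, its executions,
the timestamps of operations, and causal consistency.
Servers are `Fin N`, objects are `Fin K`, `C` is the set of clients, `I` the set of operation
identifiers, `V` the alphabet of the objects and `W i` the alphabet of the codeword symbol of
server `i`.
-/

noncomputable section

open Classical

namespace CausalEC

universe uF uV uW uC uI

/-! ### The erasure code and the static parameters -/

section Code

variable {N K : ℕ} {F : Type uF} {V : Type uV} {W : Fin N → Type uW}
  [Field F] [AddCommGroup V] [Module F V] [∀ i, AddCommGroup (W i)] [∀ i, Module F (W i)]

/-- `T` is a recovery set of object `k`: the value of object `k` is a function of the codeword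
symbols at the servers in `T`. -/
def IsRecoverySet (Φ : ∀ i : Fin N, (Fin K → V) →ₗ[F] W i) (k : Fin K) (T : Finset (Fin N)) :
    Prop :=
  ∃ ψ : (∀ j : T, W j) → V, ∀ x : Fin K → V, ψ (fun j => Φ j x) = x k

/-- `k ∈ 𝒳_s`: the encoding function of server `s` depends on object `k`. -/
def StoresObject (Φ : ∀ i : Fin N, (Fin K → V) →ₗ[F] W i) (s : Fin N) (k : Fin K) : Prop :=
  ∃ x x' : Fin K → V, (∀ m, m ≠ k → x m = x' m) ∧ Φ s x ≠ Φ s x'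

/-- `g` is a re-encoding function `Γ_{i,k}` for server `i` and object `k`. -/
def IsReencoding (Φ : ∀ i : Fin N, (Fin K → V) →ₗ[F] W i) (i : Fin N) (k : Fin K)
    (g : W i → V → V → W i) : Prop :=
  ∀ x x' : Fin K → V, (∀ m, m ≠ k → x m = x' m) →
    g (Φ i x) (x k) (x' k) = Φ i x' ∧
    g (Φ i x) 0 (x' k - x k) = Φ i x' ∧
    g (Φ i x) (x k - x' k) 0 = Φ i x'

end Code

/-- What an instance of the algorithm is parametrized by: a linear code with encoding functions
`Φ`, some re-encoding functions `Γ` and some decoding functions `Ψ` for it (such functions exist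
for every linear code), and the clients with their identifiers and their servers. -/
structure Params (N K : ℕ) (F : Type uF) (V : Type uV) (W : Fin N → Type uW) (C : Type uC)
    [Field F] [AddCommGroup V] [Module F V] [∀ i, AddCommGroup (W i)] [∀ i, Module F (W i)] where
  /-- encoding functions -/
  Φ : ∀ i : Fin N, (Fin K → V) →ₗ[F] W i
  /-- re-encoding functions -/
  Γ : ∀ i : Fin N, Fin K → W i → V → V → W i
  isReencoding : ∀ i k, IsReencoding Φ i k (Γ i k)
  /-- decoding functions; only their values at recovery sets matter -/
  Ψ : ∀ (_ : Fin K) (T : Finset (Fin N)), (∀ j : T, W j) → V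
  decodes : ∀ k T, IsRecoverySet Φ k T → ∀ x : Fin K → V, Ψ k T (fun j => Φ j x) = x k
  /-- `home c = s` means that client `c` belongs to `𝒞_s` -/
  home : C → Fin N
  /-- the identifier of a client -/
  cid : C → ℕ
  cid_injective : Function.Injective cid

/-! ### Tags -/

/-- A tag is a vector clock value together with a client identifier. -/
structure Tag (N : ℕ) where
  ts : Fin N → ℕ
  id : ℕ

instance (N : ℕ) : Zero (Tag N) := ⟨⟨0, 0⟩⟩

/-- Vector clocks are compared componentwise; tags with incomparable (or equal) vector clocks are
compared by the client identifiers. This comparison is not transitive in general. -/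
instance (N : ℕ) : LT (Tag N) :=
  ⟨fun a b => a.ts < b.ts ∨ (¬ b.ts < a.ts ∧ a.id < b.id)⟩

instance (N : ℕ) : LE (Tag N) := ⟨fun a b => a = b ∨ a < b⟩

/-- `t = max A`. Because the comparison of tags need not be transitive, a set `A` of tags may lack
a highest element; then `t` may be any element of `A`. -/
def IsMaxTag {N : ℕ} (A : Set (Tag N)) (t : Tag N) : Prop :=
  t ∈ A ∧ ((∃ m ∈ A, ∀ a ∈ A, a ≤ m) → ∀ a ∈ A, a ≤ t)

/-- `q` is the highest tagged entry of the list `l`, and `none` if the list is empty. -/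
def IsHighestTagged {N : ℕ} {V : Type uV} (l : Set (Tag N × V)) : Option (Tag N × V) → Prop
  | none => l = ∅
  | some p => p ∈ l ∧ IsMaxTag {t | ∃ v, (t, v) ∈ l} p.1

/-! ### Messages and states -/

/-- The operations that clients can invoke. -/
inductive Op (K : ℕ) (V : Type uV) where
  | write (X : Fin K) (v : V)
  | read (X : Fin K)

/-- The responses of a server to a client. -/
inductive Resp (V : Type uV) (I : Type uI) where
  | writeAck (o : I)
  | readReturn (o : I) (v : V)

/-- The response belongs to the operation with identifier `o`. -/
def Resp.Answers {K : ℕ} {V : Type uV} {I : Type uI} (o : I) : Op K V → Resp V I → Prop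
  | .write _ _, r => r = .writeAck o
  | .read _, r => ∃ v, r = .readReturn o v

/-- A codeword symbol together with a tag for every object. -/
structure Symbol (N K : ℕ) (w : Type uW) where
  val : w
  tagvec : Fin K → Tag N

/-- The messages that server `i` sends to other servers. In `valInq`, `valResp` and
`valRespEncoded` the client `none` is `localhost`. -/
inductive Msg {N : ℕ} (K : ℕ) (V : Type uV) (W : Fin N → Type uW) (C : Type uC) (I : Type uI)
    (i : Fin N) where
  | app (X : Fin K) (v : V) (t : Tag N)
  | del (X : Fin K) (t : Tag N)
  | valInq (client : Option C) (o : I) (X : Fin K) (wanted : Fin K → Tag N)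
  | valResp (X : Fin K) (v : V) (client : Option C) (o : I) (requested : Fin K → Tag N)
  | valRespEncoded (m : Symbol N K (W i)) (client : Option C) (o : I) (X : Fin K)
      (requested : Fin K → Tag N)

/-- An entry of the list of pending reads. The client `none` is `localhost`, and `none` in `syms`
is `⊥`. -/
@[ext] structure ReadEntry {N : ℕ} (K : ℕ) (W : Fin N → Type uW) (C : Type uC) (I : Type uI) where
  client : Option C
  opid : I
  obj : Fin K
  tagvec : Fin K → Tag N
  syms : ∀ i : Fin N, Option (W i)

/-- The state variables of server `s`. -/
structure ServerState {N : ℕ} (K : ℕ) (V : Type uV) (W : Fin N → Type uW) (C : Type uC)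
    (I : Type uI) (s : Fin N) where
  vc : Fin N → ℕ
  inQueue : Set (Fin N × Fin K × V × Tag N)
  L : Fin K → Set (Tag N × V)
  delL : Fin K → Set (Tag N × Fin N)
  M : Symbol N K (W s)
  readL : Set (ReadEntry K W C I)
  error1 : Fin K → Bool
  error2 : Fin K → Bool
  tmax : Fin K → Tag N

/-- What a transition of server `s` can change: its state, the contents of its outgoing channels
`c_{s → j}`, the responses in transit to the clients, and the set of the operation identifiers
that have been used. -/
structure Loc {N : ℕ} (K : ℕ) (V : Type uV) (W : Fin N → Type uW) (C : Type uC)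
    (I : Type uI) (s : Fin N) where
  st : ServerState K V W C I s
  out : Fin N → List (Msg K V W C I s)
  resps : C → Set (Resp V I)
  used : Set I

/-- A state of the whole system. The channels between servers are first-in-first-out queues, with
the oldest message at the head of the list. The messages between a client and its server are kept
in the sets `reqs` and `resps`. -/
structure Config {N : ℕ} (K : ℕ) (V : Type uV) (W : Fin N → Type uW) (C : Type uC)
    (I : Type uI) where
  srv : ∀ s : Fin N, ServerState K V W C I s
  chan : ∀ i : Fin N, Fin N → List (Msg K V W C I i)
  reqs : C → Set (I × Op K V)
  resps : C → Set (Resp V I)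
  pending : C → Option (I × Op K V)
  used : Set I
  haltedServers : Set (Fin N)
  haltedClients : Set C

/-! ### The server protocol -/

section Protocol

variable {N K : ℕ} {F : Type uF} {V : Type uV} {W : Fin N → Type uW} {C : Type uC} {I : Type uI}
  [Field F] [AddCommGroup V] [Module F V] [∀ i, AddCommGroup (W i)] [∀ i, Module F (W i)]

/-- Send `m` to every node other than `s` that satisfies `P`. -/
def Loc.send {s : Fin N} (a : Loc K V W C I s) (P : Fin N → Prop) (m : Msg K V W C I s) :
    Loc K V W C I s :=
  { a with out := fun j => if j ≠ s ∧ P j then a.out j ++ [m] else a.out j }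

/-- Send the response `r` to client `c`. -/
def Loc.reply {s : Fin N} (a : Loc K V W C I s) (c : C) (r : Resp V I) : Loc K V W C I s :=
  { a with resps := Function.update a.resps c (a.resps c ∪ {r}) }

/-- Send `read-return` with value `v` for every entry in `D` that belongs to a client, and remove
the entries in `D` from the list of pending reads. -/
def Loc.clearReads {s : Fin N} (a : Loc K V W C I s) (D : Set (ReadEntry K W C I)) (v : V) :
    Loc K V W C I s :=
  { a with
    st := { a.st with readL := a.st.readL \ D }
    resps := fun c => a.resps c ∪
      {r | ∃ e ∈ a.st.readL ∩ D, e.client = some c ∧ r = .readReturn e.opid v} }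

/-- Add `(t, v)` to the list of object `X`. -/
def ServerState.addToL {s : Fin N} (σ : ServerState K V W C I s) (X : Fin K) (t : Tag N) (v : V) :
    ServerState K V W C I s :=
  { σ with L := Function.update σ.L X (σ.L X ∪ {(t, v)}) }

/-- The vector of codeword symbols with `w` at server `s` and `⊥` elsewhere. -/
def onlyAt (s : Fin N) (w : W s) : ∀ i : Fin N, Option (W i) :=
  Function.update (fun _ => none) s (some w)

/-- `T` is a recovery set of object `k`, the symbols at `T` are all present in `w`, and `v` is the
value that is decoded from them. -/
def Params.Decode (P : Params N K F V W C) (k : Fin K) (T : Finset (Fin N))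
    (w : ∀ i : Fin N, Option (W i)) (v : V) : Prop :=
  IsRecoverySet P.Φ k T ∧ ∃ u : ∀ j : T, W j, (∀ j : T, w j = some (u j)) ∧ v = P.Ψ k T u

/-- The iterations of a loop over a list of objects, one after the other. -/
inductive Loop {σ : Type*} (step : Fin K → σ → σ → Prop) : List (Fin K) → σ → σ → Prop
  | nil (a : σ) : Loop step [] a a
  | cons {X : Fin K} {l : List (Fin K)} {a b c : σ} :
      step X a b → Loop step l b c → Loop step (X :: l) a c

/-- A loop over all objects, each taken once, in an arbitrary order. -/
def ForEach {σ : Type*} (step : Fin K → σ → σ → Prop) (a b : σ) : Prop :=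
  ∃ l : List (Fin K), l.Nodup ∧ (∀ X, X ∈ l) ∧ Loop step l a b

variable (P : Params N K F V W C) (s : Fin N)

/-- On receipt of `write(o, X, v)` from client `c`. -/
def onWrite (c : C) (o : I) (X : Fin K) (v : V) (a b : Loc K V W C I s) : Prop :=
  let vc' := Function.update a.st.vc s (a.st.vc s + 1)
  let t : Tag N := ⟨vc', P.cid c⟩
  let a₁ : Loc K V W C I s := { a with st := { a.st with vc := vc' }.addToL X t v }
  b = ((a₁.reply c (.writeAck o)).send (fun _ => True) (.app X v t)).clearReads
        {e | e.client ≠ none ∧ e.obj = X} v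

/-- On receipt of `read(o, X)` from client `c`. -/
def onRead (c : C) (o : I) (X : Fin K) (a b : Loc K V W C I s) : Prop :=
  ∃ q, IsHighestTagged (a.st.L X) q ∧
    if ∃ p, q = some p ∧ a.st.M.tagvec X ≤ p.1 then
      ∃ p, q = some p ∧ b = a.reply c (.readReturn o p.2)
    else if IsRecoverySet P.Φ X {s} then
      ∃ v, P.Decode X {s} (onlyAt s a.st.M.val) v ∧ b = a.reply c (.readReturn o v)
    else
      b = Loc.send
        { a with st := { a.st with
            readL := a.st.readL ∪ {⟨some c, o, X, a.st.M.tagvec, onlyAt s a.st.M.val⟩} } }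
        (fun _ => True) (.valInq (some c) o X a.st.M.tagvec)

/-- On receipt of a request of client `c`. -/
def onRequest (c : C) (o : I) : Op K V → Loc K V W C I s → Loc K V W C I s → Prop
  | .write X v => onWrite P s c o X v
  | .read X => onRead P s c o X

/-- One iteration, for object `X`, of the loop that prepares the answer to a `val_inq` message. -/
def responseStep (σ : ServerState K V W C I s) (wanted : Fin K → Tag N) (X : Fin K)
    (r r' : Symbol N K (W s)) : Prop :=
  if StoresObject P.Φ s X ∧ σ.M.tagvec X ≠ wanted X ∧ (∃! v, (σ.M.tagvec X, v) ∈ σ.L X) then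
    ∃ v, (σ.M.tagvec X, v) ∈ σ.L X ∧
      if ∃! w, (wanted X, w) ∈ σ.L X then
        ∃ w, (wanted X, w) ∈ σ.L X ∧
          r' = ⟨P.Γ s X (P.Γ s X r.val v 0) 0 w, Function.update r.tagvec X (wanted X)⟩
      else
        r' = ⟨P.Γ s X r.val v 0, Function.update r.tagvec X 0⟩
  else r' = r

/-- On receipt of `val_inq` from node `j`. -/
def onValInq (j : Fin N) (client : Option C) (o : I) (X : Fin K) (wanted : Fin K → Tag N)
    (a b : Loc K V W C I s) : Prop :=
  if ∃ v, (wanted X, v) ∈ a.st.L X then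
    ∃ v, (wanted X, v) ∈ a.st.L X ∧ b = a.send (fun i => i = j) (.valResp X v client o wanted)
  else
    ∃ r, ForEach (responseStep P s a.st wanted) a.st.M r ∧
      b = a.send (fun i => i = j) (.valRespEncoded r client o X wanted)

/-- On receipt of `val_resp`. -/
def onValResp (X : Fin K) (v : V) (client : Option C) (o : I) (requested : Fin K → Tag N)
    (a b : Loc K V W C I s) : Prop :=
  if ∃ w, (⟨client, o, X, requested, w⟩ : ReadEntry K W C I) ∈ a.st.readL then
    ∃ w, (⟨client, o, X, requested, w⟩ : ReadEntry K W C I) ∈ a.st.readL ∧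
      let σ : ServerState K V W C I s :=
        { a.st with readL := a.st.readL \ {⟨client, o, X, requested, w⟩} }
      match client with
      | none => b = { a with st := σ.addToL X (requested X) v }
      | some c => b = Loc.reply { a with st := σ } c (.readReturn o v)
  else b = a

/-- The variables changed by the loop that modifies a codeword symbol received from node `j`. -/
structure Modif (K : ℕ) (w : Type uW) where
  codeword : w
  error1 : Fin K → Bool
  error2 : Fin K → Bool

/-- One iteration, for object `X`, of the loop that modifies the codeword symbol `m` received from
node `j`: first remove the version of `X` in it, then insert the requested version. -/
def modifyStep (σ : ServerState K V W C I s) (j : Fin N) (m : Symbol N K (W j))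
    (requested : Fin K → Tag N) (X : Fin K) (r r' : Modif K (W j)) : Prop :=
  if StoresObject P.Φ j X ∧ requested X ≠ m.tagvec X then
    ∃ r₁ : Modif K (W j),
      (if m.tagvec X ≠ 0 ∧ (∃! w, (m.tagvec X, w) ∈ σ.L X) then
        ∃ w, (m.tagvec X, w) ∈ σ.L X ∧ r₁ = { r with codeword := P.Γ j X r.codeword w 0 }
      else if m.tagvec X ≠ 0 then
        r₁ = { r with error1 := Function.update r.error1 X true }
      else r₁ = r) ∧
      (if r₁.error1 X = false ∧ (∃! v, (requested X, v) ∈ σ.L X) then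
        ∃ v, (requested X, v) ∈ σ.L X ∧ r' = { r₁ with codeword := P.Γ j X r₁.codeword 0 v }
      else r' = { r₁ with error2 := Function.update r₁.error2 X true })
  else r' = r

/-- On receipt of `val_resp_encoded` with codeword symbol `m` from node `j`. -/
def onValRespEncoded (j : Fin N) (m : Symbol N K (W j)) (client : Option C) (o : I) (X : Fin K)
    (requested : Fin K → Tag N) (a b : Loc K V W C I s) : Prop :=
  if ∃ w, (⟨client, o, X, requested, w⟩ : ReadEntry K W C I) ∈ a.st.readL then
    ∃ w, (⟨client, o, X, requested, w⟩ : ReadEntry K W C I) ∈ a.st.readL ∧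
    ∃ r : Modif K (W j),
      ForEach (modifyStep P s a.st j m requested)
        ⟨m.val, fun _ => false, fun _ => false⟩ r ∧
      let σ : ServerState K V W C I s := { a.st with error1 := r.error1, error2 := r.error2 }
      if ∀ Y, r.error1 Y = false ∧ r.error2 Y = false then
        let w' := Function.update w j (some r.codeword)
        if ∃ T v, P.Decode X T w' v then
          ∃ T v, P.Decode X T w' v ∧
            let σ' : ServerState K V W C I s :=
              { σ with readL := {e ∈ σ.readL | ¬ (e.client = client ∧ e.opid = o ∧ e.obj = X ∧
                  e.tagvec = requested)} }
            match client with
            | none => b = { a with st := σ'.addToL X (σ'.M.tagvec X) v }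
            | some c => b = Loc.reply { a with st := σ' } c (.readReturn o v)
        else
          b = { a with st := { σ with readL :=
                  (σ.readL \ {⟨client, o, X, requested, w⟩}) ∪
                    {⟨client, o, X, requested, w'⟩} } }
      else b = { a with st := σ }
  else b = { a with st := { a.st with error1 := fun _ => false, error2 := fun _ => false } }

/-- On receipt of a message from node `j`. -/
def onMsg (j : Fin N) : Msg K V W C I j → Loc K V W C I s → Loc K V W C I s → Prop
  | .app X v t => fun a b =>
      b = { a with st := { a.st with inQueue := a.st.inQueue ∪ {(j, X, v, t)} } }
  | .del X t => fun a b =>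
      b = { a with st := { a.st with
              delL := Function.update a.st.delL X (a.st.delL X ∪ {(t, j)}) } }
  | .valInq client o X wanted => onValInq P s j client o X wanted
  | .valResp X v client o requested => onValResp s X v client o requested
  | .valRespEncoded m client o X requested => onValRespEncoded P s j m client o X requested

/-- The internal action `Apply_InQueue`. The head of the queue is an entry with a minimal
timestamp, ties being broken arbitrarily. -/
def applyInQueue (a b : Loc K V W C I s) : Prop :=
  ∃ (j : Fin N) (X : Fin K) (v : V) (t : Tag N),
    (j, X, v, t) ∈ a.st.inQueue ∧ (∀ q ∈ a.st.inQueue, ¬ q.2.2.2.ts < t.ts) ∧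
    if (∀ p, p ≠ j → t.ts p ≤ a.st.vc p) ∧ t.ts j = a.st.vc j + 1 then
      let a₁ : Loc K V W C I s :=
        { a with st := { a.st with
            inQueue := a.st.inQueue \ {(j, X, v, t)}
            vc := Function.update a.st.vc j (t.ts j) }.addToL X t v }
      b = a₁.clearReads
        {e | e.obj = X ∧ ((e.client ≠ none ∧ e.tagvec X ≤ t) ∨
          (e.client = none ∧ e.tagvec X = t))} v
    else b = a

/-- The tags `t` of object `X` such that every node that stores `X` is known to have sent `del`
with a tag at least `t`. -/
def deletedAtStores (σ : ServerState K V W C I s) (X : Fin K) : Set (Tag N) :=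
  {t | ∀ i, StoresObject P.Φ i X → ∃ t', (t', i) ∈ σ.delL X ∧ t ≤ t'}

/-- The first part of `Encoding`, for an object `X ∈ 𝒳_s`. -/
def encodeStored (X : Fin K) (a b : Loc K V W C I s) : Prop :=
  ∃ q, IsHighestTagged (a.st.L X) q ∧
    if StoresObject P.Φ s X ∧ ∃ p, q = some p ∧ a.st.M.tagvec X < p.1 then
      ∃ p, q = some p ∧
        if ∃ val, (a.st.M.tagvec X, val) ∈ a.st.L X then
          ∃ val v, (a.st.M.tagvec X, val) ∈ a.st.L X ∧ (p.1, v) ∈ a.st.L X ∧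
            b = Loc.send
              { a with st := { a.st with
                  M := ⟨P.Γ s X a.st.M.val val v, Function.update a.st.M.tagvec X p.1⟩
                  delL := Function.update a.st.delL X (a.st.delL X ∪ {(p.1, s)}) } }
              (fun i => StoresObject P.Φ i X) (.del X p.1)
        else if ∃ e ∈ a.st.readL, e.client = none ∧ e.obj = X ∧
            e.tagvec X = a.st.M.tagvec X then
          b = a
        else
          ∃ o, o ∉ a.used ∧
            b = Loc.send
              { a with
                st := { a.st with readL := a.st.readL ∪
                    {⟨none, o, X, a.st.M.tagvec, onlyAt s a.st.M.val⟩} }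
                used := a.used ∪ {o} }
              (fun _ => True) (.valInq none o X a.st.M.tagvec)
    else b = a

/-- The second part of `Encoding`, for an object `X ∉ 𝒳_s`. -/
def encodeNotStored (X : Fin K) (a b : Loc K V W C I s) : Prop :=
  ∃ q, IsHighestTagged (a.st.L X) q ∧
    let U' := deletedAtStores P s a.st X ∩
      {t | (∃ val, (t, val) ∈ a.st.L X) ∧ a.st.M.tagvec X < t}
    if ¬ StoresObject P.Φ s X ∧ (∃ p, q = some p ∧ a.st.M.tagvec X < p.1) ∧ U'.Nonempty then
      ∃ t, IsMaxTag U' t ∧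
        b = Loc.send
          { a with st := { a.st with
              M := ⟨a.st.M.val, Function.update a.st.M.tagvec X t⟩
              delL := Function.update a.st.delL X (a.st.delL X ∪ {(t, s)}) } }
          (fun _ => True) (.del X t)
    else b = a

/-- The internal action `Encoding`. -/
def encoding (a b : Loc K V W C I s) : Prop :=
  ∃ a₁, ForEach (encodeStored P s) a a₁ ∧ ForEach (encodeNotStored P s) a₁ b

/-- The internal action `Garbage_Collection`, for object `X`. -/
def collectStep (X : Fin K) (a b : Loc K V W C I s) : Prop :=
  ∃ q tm, IsHighestTagged (a.st.L X) q ∧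
    let S : Set (Tag N) := {t | ∀ i, ∃ t', (t', i) ∈ a.st.delL X ∧ t ≤ t'}
    let S' : Set (Tag N) := {t | ∀ i, (t, i) ∈ a.st.delL X}
    let m := a.st.M.tagvec X
    let T : Set (Tag N) := {t | ∃ e ∈ a.st.readL, e.tagvec X = t ∧ t < m}
    let U := deletedAtStores P s a.st X
    (if S.Nonempty then IsMaxTag S tm else tm = a.st.tmax X) ∧
    let D : Set (Tag N × V) :=
      if tm = m ∧ m ∈ S' ∧ (∀ p, q = some p → p.1 ≤ m) then
        {p | p.1 ≤ tm ∧ p.1 ∉ T}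
      else if tm < m ∧ ¬ StoresObject P.Φ s X then
        {p | p.1 ≤ tm ∧ p.1 ∉ T}
      else {p | p.1 < tm ∧ p.1 ∉ T}
    let a₁ : Loc K V W C I s :=
      { a with st := { a.st with
          tmax := Function.update a.st.tmax X tm
          L := Function.update a.st.L X (a.st.L X \ D) } }
    if U.Nonempty ∧ StoresObject P.Φ s X then
      ∃ u, IsMaxTag U u ∧ b = a₁.send (fun _ => True) (.del X u)
    else b = a₁

/-- The internal action `Garbage_Collection`. -/
def garbageCollection (a b : Loc K V W C I s) : Prop :=
  ForEach (collectStep P s) a b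

end Protocol

/-! ### The composed system and its executions -/

section System

variable {N K : ℕ} {F : Type uF} {V : Type uV} {W : Fin N → Type uW} {C : Type uC} {I : Type uI}
  [Field F] [AddCommGroup V] [Module F V] [∀ i, AddCommGroup (W i)] [∀ i, Module F (W i)]

/-- The part of the system state that transitions of server `s` can change. -/
def Config.view (γ : Config K V W C I) (s : Fin N) : Loc K V W C I s :=
  ⟨γ.srv s, γ.chan s, γ.resps, γ.used⟩

/-- Write back the part of the system state that belongs to server `s`. -/
def Config.put (γ : Config K V W C I) (s : Fin N) (a : Loc K V W C I s) : Config K V W C I :=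
  { γ with
    srv := Function.update γ.srv s a.st
    chan := Function.update γ.chan s a.out
    resps := a.resps
    used := a.used }

/-- The initial state of server `s`. -/
def ServerState.initial (s : Fin N) : ServerState K V W C I s where
  vc := 0
  inQueue := ∅
  L := fun _ => {(0, 0)}
  delL := fun _ => ∅
  M := ⟨0, fun _ => 0⟩
  readL := ∅
  error1 := fun _ => false
  error2 := fun _ => false
  tmax := fun _ => 0

/-- The initial state of the system. -/
def Config.initial : Config K V W C I where
  srv := fun s => ServerState.initial s
  chan := fun _ _ => []
  reqs := fun _ => ∅
  resps := fun _ => ∅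
  pending := fun _ => none
  used := ∅
  haltedServers := ∅
  haltedClients := ∅

/-- The actions of the system. -/
inductive Action (N K : ℕ) (V : Type uV) (C : Type uC) (I : Type uI) where
  /-- client `c` gets an invocation and sends the request to its server -/
  | invoke (c : C) (o : I) (op : Op K V)
  /-- the server of client `c` receives a request of `c` -/
  | request (c : C) (o : I) (op : Op K V)
  /-- server `s` receives the next message from server `i` -/
  | receive (i s : Fin N)
  | applyInQueue (s : Fin N)
  | encoding (s : Fin N)
  | garbageCollection (s : Fin N)
  /-- client `c` receives a response of its server, which completes the pending operation if it
  belongs to it -/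
  | respond (c : C) (r : Resp V I)
  | haltServer (s : Fin N)
  | haltClient (c : C)

/-- The transitions of the system. A client has at most one pending operation, and every operation
has a fresh identifier. -/
def Step (P : Params N K F V W C) (γ : Config K V W C I) :
    Action N K V C I → Config K V W C I → Prop
  | .invoke c o op, γ' =>
      c ∉ γ.haltedClients ∧ γ.pending c = none ∧ o ∉ γ.used ∧
      γ' = { γ with
        pending := Function.update γ.pending c (some (o, op))
        reqs := Function.update γ.reqs c (γ.reqs c ∪ {(o, op)})
        used := γ.used ∪ {o} }
  | .request c o op, γ' =>
      P.home c ∉ γ.haltedServers ∧ (o, op) ∈ γ.reqs c ∧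
      ∃ b, onRequest P (P.home c) c o op (γ.view (P.home c)) b ∧
        γ' = Config.put
          { γ with reqs := Function.update γ.reqs c (γ.reqs c \ {(o, op)}) } (P.home c) b
  | .receive i s, γ' =>
      s ∉ γ.haltedServers ∧ i ≠ s ∧
      ∃ m rest b, γ.chan i s = m :: rest ∧ onMsg P s i m (γ.view s) b ∧
        γ' = Config.put
          { γ with chan := Function.update γ.chan i (Function.update (γ.chan i) s rest) } s b
  | .applyInQueue s, γ' =>
      s ∉ γ.haltedServers ∧ ∃ b, applyInQueue s (γ.view s) b ∧ γ' = γ.put s b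
  | .encoding s, γ' =>
      s ∉ γ.haltedServers ∧ ∃ b, encoding P s (γ.view s) b ∧ γ' = γ.put s b
  | .garbageCollection s, γ' =>
      s ∉ γ.haltedServers ∧ ∃ b, garbageCollection P s (γ.view s) b ∧ γ' = γ.put s b
  | .respond c r, γ' =>
      c ∉ γ.haltedClients ∧ r ∈ γ.resps c ∧
      γ' = { γ with
        resps := Function.update γ.resps c (γ.resps c \ {r})
        pending := if ∃ o op, γ.pending c = some (o, op) ∧ r.Answers o op then
            Function.update γ.pending c none else γ.pending }
  | .haltServer s, γ' => γ' = { γ with haltedServers := γ.haltedServers ∪ {s} }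
  | .haltClient c, γ' => γ' = { γ with haltedClients := γ.haltedClients ∪ {c} }

/-- A finite or infinite execution: `state 0, act 0, state 1, act 1, …` with `len` actions. The
values `act i` for `i ≥ len` and `state i` for `i > len` are not part of the execution. -/
structure Execution (P : Params N K F V W C) (I : Type uI) where
  len : ℕ∞
  state : ℕ → Config K V W C I
  act : ℕ → Action N K V C I
  init_eq : state 0 = Config.initial
  step : ∀ i : ℕ, (i : ℕ∞) < len → Step P (state i) (act i) (state (i + 1))

/-! ### Operations, timestamps and causal consistency -/

variable {P : Params N K F V W C}

/-- An invocation that occurs in the execution. -/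
structure Invocation (β : Execution P I) where
  idx : ℕ
  client : C
  opid : I
  op : Op K V
  idx_lt : (idx : ℕ∞) < β.len
  act_eq : β.act idx = .invoke client opid op

/-- The operations of an execution are those that clients invoke and, for every object, an initial
write of the initial value `0`. -/
inductive Operation (β : Execution P I) where
  | initial (X : Fin K)
  | invoked (π : Invocation β)

variable {β : Execution P I}

/-- `π` is a write of `v` to object `X`. -/
def Operation.IsWrite : Operation β → Fin K → V → Prop
  | .initial Y, X, v => Y = X ∧ v = 0
  | .invoked π, X, v => π.op = .write X v

/-- `π` is a read of object `X`. -/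
def Operation.IsRead : Operation β → Fin K → Prop
  | .initial _, _ => False
  | .invoked π, X => π.op = .read X

/-- The read `π` completes in the execution and returns `v`. -/
def Operation.Returns : Operation β → V → Prop
  | .initial _, _ => False
  | .invoked π, v => (∃ X, π.op = .read X) ∧ ∃ n : ℕ, (n : ℕ∞) < β.len ∧
      (β.state n).pending π.client = some (π.opid, π.op) ∧
      β.act n = .respond π.client (.readReturn π.opid v)

/-- At point `n` a response to `π` is in transit to the client. -/
def Invocation.ResponseAt (π : Invocation β) (n : ℕ) : Prop :=
  ∃ r ∈ (β.state n).resps π.client, r.Answers π.opid π.op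

/-- `π` has the timestamp `T`: the vector clock of the server of the client at the first point at
which this server has sent a response to `π`. Initial writes have timestamp `0`. -/
def Operation.HasTimestamp : Operation β → (Fin N → ℕ) → Prop
  | .initial _, T => T = 0
  | .invoked π, T => ∃ n : ℕ, (n : ℕ∞) ≤ β.len ∧ π.ResponseAt n ∧ (∀ m < n, ¬ π.ResponseAt m) ∧
      T = ((β.state n).srv (P.home π.client)).vc

/-- The program order `π₁ → π₂`: both are invoked by the same client, and `π₁` comes first. -/
def ProgramOrder : Operation β → Operation β → Prop
  | .invoked π₁, .invoked π₂ => π₁.client = π₂.client ∧ π₁.idx < π₂.idx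
  | _, _ => False

/-- The order `π₁ ⇝ π₂` built from the timestamps. -/
def TimestampOrder (π₁ π₂ : Operation β) : Prop :=
  (∃ T₁ T₂, π₁.HasTimestamp T₁ ∧ π₂.HasTimestamp T₂ ∧ T₁ < T₂) ∨
  (∃ T, π₁.HasTimestamp T ∧ π₂.HasTimestamp T ∧ (∃ X v, π₁.IsWrite X v) ∧ ∃ X, π₂.IsRead X) ∨
  (∃ T, π₁.HasTimestamp T ∧ π₂.HasTimestamp T ∧ (∃ X, π₁.IsRead X) ∧ (∃ X, π₂.IsRead X) ∧
    ProgramOrder π₁ π₂) ∨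
  ((∃ T, π₁.HasTimestamp T) ∧ ¬ ∃ T, π₂.HasTimestamp T)

/-- With respect to the order `r`, the read `π` of object `X` that returns `v` reads from the write
`φ`: `φ` precedes `π`, writes `v` to `X`, and no other write of `v` to `X` lies between them. -/
def ReadsFrom (r : Operation β → Operation β → Prop) (π : Operation β) (X : Fin K) (v : V)
    (φ : Operation β) : Prop :=
  r φ π ∧ φ.IsWrite X v ∧ ∀ ω, r φ ω → r ω π → ¬ ω.IsWrite X v

/-- The partial order `r` on the operations witnesses that the execution is causally consistent. -/
structure IsCausalOrder (r : Operation β → Operation β → Prop) : Prop where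
  isStrictOrder : IsStrictOrder (Operation β) r
  programOrder : ∀ π₁ π₂, ProgramOrder π₁ π₂ → r π₁ π₂
  reads : ∀ π X v, π.IsRead X → π.Returns v → ∃! φ, ReadsFrom r π X v φ

/-- Causal consistency of an execution. -/
def CausallyConsistent (β : Execution P I) : Prop :=
  ∃ r : Operation β → Operation β → Prop, IsCausalOrder r

end System

end CausalEC

end

/-!
Call every pair of a tag and a value that some write has created so far a version. Each stored
symbol and each symbol in a message encodes a data vector of versions, namely those named by the
tags next to it, and the symbols that a pending read has collected all belong to the data vector of
versions named by its tag vector: re-encoding trades one version for another, and the error checks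
of the algorithm exclude mixtures. Hence decoding can only yield versions. Moreover the timestamps
of the versions in the list, in the symbol and in a pending read never exceed the vector clock, so
a read returns the value of a write with a timestamp below its own.

Tags are unique because a write increases its own component of the clock and no clock ever counts a
write that has not happened. Program order respects timestamps because clocks never decrease, and a
write increases the clock strictly. For unique reads-from, order the operations by the sum of the
entries of the timestamp; among equal sums put writes before reads, reads in the order of their
invocation and writes in the reverse of theirs, so that every read has a last write of its value.
-/

section

open Classical

namespace CausalEC

universe uF uV uW uC uI

/-! ### Loops -/

theorem Loop.invariant {K : ℕ} {σ : Type*} {step : Fin K → σ → σ → Prop}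
    {Inv : Finset (Fin K) → σ → Prop}
    (h : ∀ X S a b, X ∉ S → step X a b → Inv (insert X S) a → Inv S b)
    {l : List (Fin K)} {a b : σ} (hl : Loop step l a b) (hn : l.Nodup) (ha : Inv l.toFinset a) :
    Inv ∅ b := by
  induction hl with
  | nil => exact ha
  | cons hs _ ih =>
    rw [List.nodup_cons] at hn
    rw [List.toFinset_cons] at ha
    exact ih hn.2 (h _ _ _ _ (by simpa using hn.1) hs ha)

/-- The finset in the invariant is the set of the objects that are still to be visited. -/
theorem ForEach.invariant {K : ℕ} {σ : Type*} {step : Fin K → σ → σ → Prop}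
    {Inv : Finset (Fin K) → σ → Prop}
    (h : ∀ X S a b, X ∉ S → step X a b → Inv (insert X S) a → Inv S b)
    {a b : σ} (hl : ForEach step a b) (ha : Inv Finset.univ a) : Inv ∅ b := by
  obtain ⟨l, hn, hall, hl⟩ := hl
  have huniv : l.toFinset = Finset.univ := Finset.eq_univ_of_forall fun X => by simpa using hall X
  exact hl.invariant h hn (huniv ▸ ha)

/-! ### Versions of the objects -/

/-- A relation between objects, tags and values: `G X t v` says that the value `v` was written to
object `X` with the tag `t`. -/
abbrev Versions (N K : ℕ) (V : Type uV) := Fin K → Tag N → V → Prop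

/-- The tag `0` stands for the initial value of every object, and a tag determines the value. -/
structure IsVersioning {N K : ℕ} {V : Type uV} [Zero V] (G : Versions N K V) : Prop where
  zero : ∀ X, G X 0 0
  unique : ∀ {X t v w}, G X t v → G X t w → v = w

/-- The data vector `x` consists of the versions with the tags `τ`. -/
def Versions.Realizes {N K : ℕ} {V : Type uV} (G : Versions N K V) (τ : Fin K → Tag N)
    (x : Fin K → V) : Prop :=
  ∀ Y, G Y (τ Y) (x Y)

theorem Versions.Realizes.update {N K : ℕ} {V : Type uV} {G : Versions N K V}
    {τ : Fin K → Tag N} {x : Fin K → V} (h : G.Realizes τ x) {X : Fin K} {t : Tag N} {v : V}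
    (hv : G X t v) : G.Realizes (Function.update τ X t) (Function.update x X v) := by
  intro Y
  by_cases hY : Y = X
  · subst hY; simpa using hv
  · simpa [hY] using h Y

section Bookkeeping

variable {N K : ℕ} {V : Type uV} {W : Fin N → Type uW} {C : Type uC} {I : Type uI} {s j : Fin N}
  {σ σ' : ServerState K V W C I s} {a : Loc K V W C I s} {X : Fin K} {c : C}

/-! ### Lists and pending reads of a server -/

theorem mem_addToL {Y : Fin K} {t t' : Tag N} {v v' : V} :
    (t', v') ∈ (σ.addToL X t v).L Y ↔ (t', v') ∈ σ.L Y ∨ (Y = X ∧ t' = t ∧ v' = v) := by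
  by_cases h : Y = X
  · subst h; simp [ServerState.addToL, or_comm]
  · simp [ServerState.addToL, h]

/-- The pending reads of client `c`. -/
def ServerState.readsOf (σ : ServerState K V W C I s) (c : C) : Set (ReadEntry K W C I) :=
  {e ∈ σ.readL | e.client = some c}

theorem ServerState.readsOf_sdiff {D : Set (ReadEntry K W C I)} (h : σ'.readL = σ.readL \ D) :
    σ'.readsOf c = σ.readsOf c \ D := by
  ext e
  simp only [readsOf, h, Set.mem_sdiff, Set.mem_ofPred_eq, and_right_comm]

theorem ServerState.readsOf_addRead {e : ReadEntry K W C I} (h : σ'.readL = σ.readL ∪ {e})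
    (hc : e.client = some c) : σ'.readsOf c = σ.readsOf c ∪ {e} := by
  ext f
  simp only [readsOf, h, Set.mem_union, Set.mem_singleton_iff, Set.mem_ofPred_eq, or_and_right]
  exact or_congr_right (and_iff_left_of_imp fun hf => hf ▸ hc)

theorem ServerState.readsOf_addRead_of_ne {e : ReadEntry K W C I} (h : σ'.readL = σ.readL ∪ {e})
    (hc : e.client ≠ some c) : σ'.readsOf c = σ.readsOf c := by
  ext f
  simp only [readsOf, h, Set.mem_union, Set.mem_singleton_iff, Set.mem_ofPred_eq, or_and_right]
  exact or_iff_left fun hf => hc (hf.1 ▸ hf.2)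

theorem Loc.mem_out_send {Q : Fin N → Prop} {m m' : Msg K V W C I s}
    (h : m' ∈ (a.send Q m).out j) : m' ∈ a.out j ∨ m' = m := by
  unfold Loc.send at h
  dsimp only at h
  split_ifs at h
  · simpa using h
  · exact Or.inl h

theorem Loc.resps_clearReads (a : Loc K V W C I s) (D : Set (ReadEntry K W C I)) (v : V) (c : C) :
    (a.clearReads D v).resps c =
      a.resps c ∪ (fun e => .readReturn e.opid v) '' (a.st.readsOf c ∩ D) := by
  ext r
  simp only [Loc.clearReads, ServerState.readsOf, Set.mem_union, Set.mem_ofPred_eq, Set.mem_image,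
    Set.mem_inter_iff, and_assoc]
  grind

/-- Complete the pending read `e` with the value `v`, which is put into the list if `e` is a
localhost read, and returned to the client otherwise. -/
def Loc.deliver (a : Loc K V W C I s) (e : ReadEntry K W C I) (v : V) : Loc K V W C I s :=
  let σ : ServerState K V W C I s := { a.st with readL := a.st.readL \ {e} }
  match e.client with
  | none => { a with st := σ.addToL e.obj (e.tagvec e.obj) v }
  | some c => Loc.reply { a with st := σ } c (.readReturn e.opid v)

end Bookkeeping

section Local

variable {N K : ℕ} {F : Type uF} {V : Type uV} {W : Fin N → Type uW} {C : Type uC} {I : Type uI}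
  [Field F] [AddCommGroup V] [Module F V] [∀ i, AddCommGroup (W i)] [∀ i, Module F (W i)]
  {P : Params N K F V W C} {G G' : Versions N K V} {s j : Fin N} {X : Fin K}

theorem IsVersioning.realizes_unique (hG : IsVersioning G) {τ : Fin K → Tag N}
    {x y : Fin K → V} (hx : G.Realizes τ x) (hy : G.Realizes τ y) : x = y :=
  funext fun Y => hG.unique (hx Y) (hy Y)

/-! ### Codeword symbols -/

theorem Params.reencode (P : Params N K F V W C) (i : Fin N) (k : Fin K) (x : Fin K → V) (v : V) :
    P.Γ i k (P.Φ i x) (x k) v = P.Φ i (Function.update x k v) := by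
  simpa using (P.isReencoding i k x (Function.update x k v)
    fun m hm => (Function.update_of_ne hm v x).symm).1

theorem encode_update_of_not_storesObject {Φ : ∀ i : Fin N, (Fin K → V) →ₗ[F] W i}
    (h : ¬ StoresObject Φ s X) (x : Fin K → V) (v : V) :
    Φ s (Function.update x X v) = Φ s x := by
  by_contra hne
  exact h ⟨_, _, fun m hm => Function.update_of_ne hm v x, hne⟩

/-- The symbols in the partial codeword `w` are those of the data vector `x`. -/
def Params.IsPartialCodeword (P : Params N K F V W C) (x : Fin K → V)
    (w : ∀ i : Fin N, Option (W i)) : Prop :=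
  ∀ i y, w i = some y → y = P.Φ i x

theorem Params.Decode.eq {k : Fin K} {T : Finset (Fin N)} {w : ∀ i : Fin N, Option (W i)} {v : V}
    (h : P.Decode k T w v) {x : Fin K → V} (hx : P.IsPartialCodeword x w) : v = x k := by
  obtain ⟨hT, u, hu, rfl⟩ := h
  obtain rfl : u = fun j : T => P.Φ j x := funext fun j => hx _ _ (hu j)
  exact P.decodes k T hT x

theorem Params.IsPartialCodeword.update {x : Fin K → V} {w : ∀ i : Fin N, Option (W i)}
    (hw : P.IsPartialCodeword x w) :
    P.IsPartialCodeword x (Function.update w j (some (P.Φ j x))) := by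
  intro i y hy
  by_cases hi : i = j
  · subst hi
    simpa using hy.symm
  · exact hw i y (by simpa [hi] using hy)

theorem Params.isPartialCodeword_onlyAt (P : Params N K F V W C) (s : Fin N) (x : Fin K → V) :
    P.IsPartialCodeword x (onlyAt s (P.Φ s x)) :=
  Params.IsPartialCodeword.update fun _ _ h => by simp at h

/-- The symbol `m` of server `j` is the encoding of the versions that its tags stand for. -/
def Encodes (P : Params N K F V W C) (G : Versions N K V) {j : Fin N} (m : Symbol N K (W j)) :
    Prop :=
  ∃ x, m.val = P.Φ j x ∧ G.Realizes m.tagvec x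

theorem Encodes.mono {m : Symbol N K (W j)} (h : Encodes P G m) (hG : G ≤ G') :
    Encodes P G' m :=
  h.imp fun _ hx => ⟨hx.1, fun Y => hG _ _ _ (hx.2 Y)⟩

theorem Encodes.reencode {y : W j} {τ : Fin K → Tag N} {t t' : Tag N} {v v' : V}
    (h : Encodes P G ⟨y, Function.update τ X t⟩) (hG : IsVersioning G) (hv : G X t v)
    (hv' : G X t' v') : Encodes P G ⟨P.Γ j X y v v', Function.update τ X t'⟩ := by
  obtain ⟨x, rfl, hx⟩ := h
  obtain rfl : v = x X := hG.unique hv (by simpa using hx X)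
  exact ⟨_, P.reencode j X x v', by simpa using hx.update hv'⟩

theorem Encodes.retag {y : W j} {τ : Fin K → Tag N} {t t' : Tag N} {v' : V}
    (h : Encodes P G ⟨y, Function.update τ X t⟩) (hst : ¬ StoresObject P.Φ j X)
    (hv' : G X t' v') : Encodes P G ⟨y, Function.update τ X t'⟩ := by
  obtain ⟨x, rfl, hx⟩ := h
  exact ⟨_, (encode_update_of_not_storesObject hst x v').symm, by simpa using hx.update hv'⟩

/-! ### States of a server -/

/-- The contents of a message agree with the versions `G`. -/
def MsgCorrect (P : Params N K F V W C) (G : Versions N K V) {j : Fin N} :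
    Msg K V W C I j → Prop
  | .app X v t => G X t v
  | .valResp X v _ _ requested => G X (requested X) v
  | .valRespEncoded m _ _ _ _ => Encodes P G m
  | _ => True

theorem MsgCorrect.mono {m : Msg K V W C I j} (h : MsgCorrect P G m) (hG : G ≤ G') :
    MsgCorrect P G' m := by
  cases m with
  | app => exact hG _ _ _ h
  | valResp => exact hG _ _ _ h
  | valRespEncoded => exact Encodes.mono h hG
  | _ => trivial

/-- The pending read `e` of server `s` agrees with the versions `G`. A localhost read concerns a
stored object, asks for the version which is encoded in the local symbol, and this version is
missing in the list. -/
structure ReadCorrect (P : Params N K F V W C) (G : Versions N K V) {s : Fin N}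
    (σ : ServerState K V W C I s) (e : ReadEntry K W C I) : Prop where
  tag_le : (e.tagvec e.obj).ts ≤ σ.vc
  syms : ∃ x, G.Realizes e.tagvec x ∧ P.IsPartialCodeword x e.syms
  home : ∀ c, e.client = some c → P.home c = s
  localhost : e.client = none → StoresObject P.Φ s e.obj ∧
    e.tagvec e.obj = σ.M.tagvec e.obj ∧ ∀ v, (σ.M.tagvec e.obj, v) ∉ σ.L e.obj

/-- The state of server `s` agrees with the versions `G`, and each client has at most one pending
read, as does localhost for each object. -/
structure ServerCorrect (P : Params N K F V W C) (G : Versions N K V) {s : Fin N}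
    (σ : ServerState K V W C I s) : Prop where
  inQueue : ∀ {j X v t}, (j, X, v, t) ∈ σ.inQueue → G X t v
  list : ∀ {X t v}, (t, v) ∈ σ.L X → G X t v ∧ t.ts ≤ σ.vc
  symbol : Encodes P G σ.M
  symbol_le : ∀ Y, (σ.M.tagvec Y).ts ≤ σ.vc
  reads : ∀ e ∈ σ.readL, ReadCorrect P G σ e
  reads_unique : ∀ e ∈ σ.readL, ∀ e' ∈ σ.readL, e.client = e'.client →
    (e.client = none → e.obj = e'.obj) → e = e'

variable {σ : ServerState K V W C I s}

theorem ServerCorrect.mono (h : ServerCorrect P G σ) (hG : G ≤ G') : ServerCorrect P G' σ :=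
  { h with
    inQueue := fun hq => hG _ _ _ (h.inQueue hq)
    list := fun hq => ⟨hG _ _ _ (h.list hq).1, (h.list hq).2⟩
    symbol := h.symbol.mono hG
    reads := fun e he =>
      { h.reads e he with
        syms := (h.reads e he).syms.imp fun _ hx => ⟨fun Y => hG _ _ _ (hx.1 Y), hx.2⟩ } }

theorem ServerCorrect.congr {σ' : ServerState K V W C I s} (h : ServerCorrect P G σ)
    (hvc : σ'.vc = σ.vc) (hqueue : σ'.inQueue = σ.inQueue) (hL : σ'.L = σ.L) (hM : σ'.M = σ.M)
    (hreadL : σ'.readL = σ.readL) : ServerCorrect P G σ' := by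
  cases σ'
  dsimp only at hvc hqueue hL hM hreadL
  subst hvc hqueue hL hM hreadL
  exact { h with reads := fun e he => { h.reads e he with } }

theorem ServerCorrect.initial (P : Params N K F V W C) (hG : ∀ X, G X 0 0) (s : Fin N) :
    ServerCorrect P G (ServerState.initial s : ServerState K V W C I s) where
  inQueue hq := hq.elim
  list hq := by
    obtain ⟨rfl, rfl⟩ := Prod.mk.inj hq
    exact ⟨hG _, le_rfl⟩
  symbol := ⟨0, (map_zero _).symm, hG⟩
  symbol_le _ := le_rfl
  reads _ he := he.elim
  reads_unique _ he := he.elim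

theorem ServerCorrect.readsOf_subsingleton (h : ServerCorrect P G σ) (c : C) :
    (σ.readsOf c).Subsingleton := fun e he e' he' =>
  h.reads_unique e he.1 e' he'.1 (he.2.trans he'.2.symm) fun hn => by simp [he.2] at hn

theorem ServerCorrect.readsOf_eq_singleton (h : ServerCorrect P G σ) {e : ReadEntry K W C I}
    (he : e ∈ σ.readL) {c : C} (hc : e.client = some c) : σ.readsOf c = {e} :=
  (h.readsOf_subsingleton c).eq_singleton_of_mem ⟨he, hc⟩

theorem ServerCorrect.readsOf_eq_empty (h : ServerCorrect P G σ) {c : C} (hc : P.home c ≠ s) :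
    σ.readsOf c = ∅ :=
  Set.eq_empty_of_forall_notMem fun e he => hc ((h.reads e he.1).home c he.2)

theorem ServerCorrect.addToL (h : ServerCorrect P G σ) {t : Tag N} {v : V} (hG : G X t v)
    (ht : t.ts ≤ σ.vc) (hl : ∀ e ∈ σ.readL, e.client = none → e.obj = X → σ.M.tagvec X ≠ t) :
    ServerCorrect P G (σ.addToL X t v) :=
  { h with
    list := fun hq => by
      rcases mem_addToL.1 hq with hq | ⟨rfl, rfl, rfl⟩
      exacts [h.list hq, ⟨hG, ht⟩]
    reads := fun e he =>
      { h.reads e he with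
        localhost := fun hc => by
          obtain ⟨hst, htag, hno⟩ := (h.reads e he).localhost hc
          refine ⟨hst, htag, fun v' hv' => ?_⟩
          rcases mem_addToL.1 hv' with hv' | ⟨rfl, ht', -⟩
          exacts [hno v' hv', hl e he hc rfl ht'] } }

theorem ServerCorrect.shrinkReads (h : ServerCorrect P G σ) {R : Set (ReadEntry K W C I)}
    (hR : R ⊆ σ.readL) : ServerCorrect P G { σ with readL := R } :=
  { h with
    reads := fun e he => { h.reads e (hR he) with }
    reads_unique := fun e he e' he' => h.reads_unique e (hR he) e' (hR he') }

theorem ServerCorrect.shrinkList (h : ServerCorrect P G σ) {L' : Fin K → Set (Tag N × V)}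
    (hL : L' ≤ σ.L) : ServerCorrect P G { σ with L := L' } :=
  { h with
    list := fun hq => h.list (hL _ hq)
    reads := fun e he =>
      { h.reads e he with
        localhost := fun hc =>
          ((h.reads e he).localhost hc).imp_right (And.imp_right fun hno v hv =>
            hno v (hL _ hv)) } }

theorem ServerCorrect.advance (h : ServerCorrect P G σ) {T : Fin N → ℕ} (hT : σ.vc ≤ T)
    {Q : Set (Fin N × Fin K × V × Tag N)} (hQ : Q ⊆ σ.inQueue) :
    ServerCorrect P G { σ with vc := T, inQueue := Q } :=
  { h with
    inQueue := fun hq => h.inQueue (hQ hq)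
    list := fun hq => ⟨(h.list hq).1, (h.list hq).2.trans hT⟩
    symbol_le := fun Y => (h.symbol_le Y).trans hT
    reads := fun e he => { h.reads e he with tag_le := (h.reads e he).tag_le.trans hT } }

theorem ServerCorrect.setSymbol (h : ServerCorrect P G σ) {t : Tag N} {v : V}
    (hv : (t, v) ∈ σ.L X) {y : W s} (hy : Encodes P G ⟨y, Function.update σ.M.tagvec X t⟩)
    (hl : ∀ e ∈ σ.readL, e.client = none → e.obj ≠ X) :
    ServerCorrect P G { σ with M := ⟨y, Function.update σ.M.tagvec X t⟩ } :=
  { h with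
    symbol := hy
    symbol_le := (Function.forall_update_iff _ fun _ (u : Tag N) => u.ts ≤ σ.vc).2
      ⟨(h.list hv).2, fun Y _ => h.symbol_le Y⟩
    reads := fun e he =>
      { h.reads e he with
        localhost := fun hc => by
          simpa only [Function.update_of_ne (hl e he hc)] using (h.reads e he).localhost hc } }

theorem ServerCorrect.addRead (h : ServerCorrect P G σ) {e : ReadEntry K W C I}
    (he : ReadCorrect P G σ e)
    (hne : ∀ f ∈ σ.readL, f.client = e.client → ¬ (e.client = none → f.obj = e.obj)) :
    ServerCorrect P G { σ with readL := σ.readL ∪ {e} } :=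
  { h with
    reads := by
      rintro f (hf | rfl)
      exacts [{ h.reads f hf with }, { he with }]
    reads_unique := by
      rintro f (hf | rfl) f' (hf' | rfl) hc ho
      · exact h.reads_unique f hf f' hf' hc ho
      · exact absurd (hc ▸ ho) (hne f hf hc)
      · exact absurd (fun hn => (ho hn).symm) (hne f' hf' hc.symm)
      · rfl }

theorem ServerCorrect.readCorrect_onlyAt (h : ServerCorrect P G σ) {cl : Option C} (o : I)
    (hhome : ∀ c, cl = some c → P.home c = s)
    (hl : cl = none → StoresObject P.Φ s X ∧ ∀ v, (σ.M.tagvec X, v) ∉ σ.L X) :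
    ReadCorrect P G σ ⟨cl, o, X, σ.M.tagvec, onlyAt s σ.M.val⟩ where
  tag_le := h.symbol_le X
  syms := by
    obtain ⟨x, hx, hxG⟩ := h.symbol
    exact ⟨x, hxG, hx ▸ P.isPartialCodeword_onlyAt s x⟩
  home := hhome
  localhost hc := ⟨(hl hc).1, rfl, (hl hc).2⟩

end Local

section Clients

variable {N K : ℕ} {V : Type uV} {W : Fin N → Type uW} {C : Type uC} {I : Type uI} {s : Fin N}
  {G : Versions N K V} {a a₁ b : Loc K V W C I s} {c : C}

/-! ### Effects on the clients -/

/-- The value `v` was written to object `X` with a timestamp of at most `T`. -/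
def Versions.VisibleAt (G : Versions N K V) (T : Fin N → ℕ) (X : Fin K) (v : V) : Prop :=
  ∃ t, G X t v ∧ t.ts ≤ T

/-- The response `r` to the operation with identifier `o`, sent while the clock of the server moves
from `T` to `U`: a write increases the clock, and a read returns a version that is visible. -/
inductive RespCorrect (G : Versions N K V) (T U : Fin N → ℕ) (o : I) : Op K V → Resp V I → Prop
  | write {X : Fin K} {v : V} (lt : T < U) : RespCorrect G T U o (.write X v) (.writeAck o)
  | read {X : Fin K} {v : V} (visible : G.VisibleAt U X v) :
      RespCorrect G T U o (.read X) (.readReturn o v)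

/-- The effect of a transition on a client that is not its cause: nothing that the client can
notice, new symbols or tags for its pending read, or an answer to its pending read. -/
inductive ClientEffect (G : Versions N K V) {s : Fin N} (a b : Loc K V W C I s) (c : C) : Prop
  | silent (reads : b.st.readsOf c = a.st.readsOf c) (resps : b.resps c = a.resps c)
  | update {e e' : ReadEntry K W C I} (before : a.st.readsOf c = {e})
      (after : b.st.readsOf c = {e'}) (opid : e'.opid = e.opid) (obj : e'.obj = e.obj)
      (resps : b.resps c = a.resps c)
  | answer {e : ReadEntry K W C I} {v : V} (before : a.st.readsOf c = {e})
      (after : b.st.readsOf c = ∅) (visible : G.VisibleAt b.st.vc e.obj v)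
      (resps : b.resps c = a.resps c ∪ {.readReturn e.opid v})

/-- The effect of receiving the request of client `c` with identifier `o`: an answer, or a new
pending read. -/
inductive RequestEffect (G : Versions N K V) {s : Fin N} (a b : Loc K V W C I s) (c : C) (o : I) :
    Op K V → Prop
  | answer {op : Op K V} {r : Resp V I} (reads : b.st.readsOf c = ∅)
      (correct : RespCorrect G a.st.vc b.st.vc o op r) (resps : b.resps c = a.resps c ∪ {r}) :
      RequestEffect G a b c o op
  | wait {e : ReadEntry K W C I} (reads : b.st.readsOf c = {e}) (opid : e.opid = o)
      (resps : b.resps c = a.resps c) : RequestEffect G a b c o (.read e.obj)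

theorem ClientEffect.clearReads (hsub : (a.st.readsOf c).Subsingleton)
    (hreads : a₁.st.readsOf c = a.st.readsOf c) (hresps : a₁.resps c = a.resps c)
    {D : Set (ReadEntry K W C I)} {v : V} (hD : ∀ e ∈ D, G.VisibleAt a₁.st.vc e.obj v) :
    ClientEffect G a (a₁.clearReads D v) c := by
  have hreads' : (a₁.clearReads D v).st.readsOf c = a.st.readsOf c \ D :=
    hreads ▸ ServerState.readsOf_sdiff rfl
  have hresps' := a₁.resps_clearReads D v c
  rw [hreads, hresps] at hresps'
  rcases (a.st.readsOf c ∩ D).eq_empty_or_nonempty with hempty | ⟨e, he, heD⟩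
  · refine .silent (hreads'.trans (Set.disjoint_iff_inter_eq_empty.2 hempty).sdiff_eq_left) ?_
    simpa [hempty] using hresps'
  · have hsingle : a.st.readsOf c = {e} := hsub.eq_singleton_of_mem he
    refine .answer hsingle ?_ (hD e heD) ?_
    · rw [hreads', hsingle, Set.sdiff_eq_empty, Set.singleton_subset_iff]
      exact heD
    · rwa [hsingle, Set.inter_eq_left.2 (Set.singleton_subset_iff.2 heD), Set.image_singleton]
        at hresps'

end Clients

section Transitions

variable {N K : ℕ} {F : Type uF} {V : Type uV} {W : Fin N → Type uW} {C : Type uC} {I : Type uI}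
  [Field F] [AddCommGroup V] [Module F V] [∀ i, AddCommGroup (W i)] [∀ i, Module F (W i)]
  {P : Params N K F V W C} {G : Versions N K V} {s j : Fin N} {X : Fin K}

/-! ### Re-encoding of the symbols in inquiries and responses -/

theorem responseStep_tagvec_of_ne {σ : ServerState K V W C I s} {wanted : Fin K → Tag N}
    {r r' : Symbol N K (W s)} (hs : responseStep P s σ wanted X r r') {Y : Fin K} (hY : Y ≠ X) :
    r'.tagvec Y = r.tagvec Y := by
  rcases ite_prop_iff_or.1 hs with ⟨-, v, -, hs⟩ | ⟨-, rfl⟩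
  · rcases ite_prop_iff_or.1 hs with ⟨-, w, -, rfl⟩ | ⟨-, rfl⟩ <;>
      exact Function.update_of_ne hY _ _
  · rfl

theorem encodes_of_responseStep (hG : IsVersioning G) {σ : ServerState K V W C I s}
    (h : ServerCorrect P G σ) {wanted : Fin K → Tag N} {r r' : Symbol N K (W s)}
    (hs : responseStep P s σ wanted X r r') (hX : r.tagvec X = σ.M.tagvec X)
    (hr : Encodes P G r) : Encodes P G r' := by
  rcases ite_prop_iff_or.1 hs with ⟨-, v, hv, hs⟩ | ⟨-, rfl⟩
  swap
  · exact hr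
  have hremoved : Encodes P G ⟨P.Γ s X r.val v 0, Function.update r.tagvec X 0⟩ :=
    Encodes.reencode (t := σ.M.tagvec X) (by rwa [← hX, Function.update_eq_self]) hG
      (h.list hv).1 (hG.zero X)
  rcases ite_prop_iff_or.1 hs with ⟨-, w, hw, rfl⟩ | ⟨-, rfl⟩
  · exact hremoved.reencode hG (hG.zero X) (h.list hw).1
  · exact hremoved

theorem encodes_of_responseLoop (hG : IsVersioning G) {σ : ServerState K V W C I s}
    (h : ServerCorrect P G σ) {wanted : Fin K → Tag N} {r : Symbol N K (W s)}
    (hl : ForEach (responseStep P s σ wanted) σ.M r) : Encodes P G r := by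
  refine (hl.invariant (Inv := fun S r => Encodes P G r ∧ ∀ Y ∈ S, r.tagvec Y = σ.M.tagvec Y)
    ?_ ⟨h.symbol, fun _ _ => rfl⟩).1
  rintro X S r r' hX hs ⟨hr, htag⟩
  refine ⟨encodes_of_responseStep hG h hs (htag X (Finset.mem_insert_self X S)) hr,
    fun Y hY => ?_⟩
  rw [responseStep_tagvec_of_ne hs (ne_of_mem_of_not_mem hY hX),
    htag Y (Finset.mem_insert_of_mem hY)]

theorem encodes_of_modifyStep (hG : IsVersioning G) {σ : ServerState K V W C I s}
    (h : ServerCorrect P G σ) {m : Symbol N K (W j)} {requested τ : Fin K → Tag N}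
    {r r' : Modif K (W j)} (hs : modifyStep P s σ j m requested X r r') {v : V}
    (hv : G X (requested X) v) (he₁ : r'.error1 X = false) (he₂ : r'.error2 X = false) :
    r.error1 = r'.error1 ∧ r.error2 = r'.error2 ∧
      (Encodes P G ⟨r.codeword, Function.update τ X (m.tagvec X)⟩ →
        Encodes P G ⟨r'.codeword, Function.update τ X (requested X)⟩) := by
  rcases ite_prop_iff_or.1 hs with ⟨-, r₁, hs₁, hs₂⟩ | ⟨hcond, rfl⟩
  · rcases ite_prop_iff_or.1 hs₂ with ⟨-, u, hu, rfl⟩ | ⟨-, rfl⟩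
    swap
    · simp at he₂
    rcases ite_prop_iff_or.1 hs₁ with ⟨-, w, hw, rfl⟩ | ⟨-, hs₁⟩
    · exact ⟨rfl, rfl, fun hr => (hr.reencode hG (h.list hw).1 (hG.zero X)).reencode hG
        (hG.zero X) (h.list hu).1⟩
    rcases ite_prop_iff_or.1 hs₁ with ⟨-, rfl⟩ | ⟨hzero, rfl⟩
    · simp at he₁
    · exact ⟨rfl, rfl, fun hr => hr.reencode hG (not_not.1 hzero ▸ hG.zero X) (h.list hu).1⟩
  · refine ⟨rfl, rfl, fun hr => ?_⟩
    by_cases hst : StoresObject P.Φ j X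
    · rwa [show requested X = m.tagvec X by tauto]
    · exact hr.retag hst hv

theorem encodes_of_modifyLoop (hG : IsVersioning G) {σ : ServerState K V W C I s}
    (h : ServerCorrect P G σ) {m : Symbol N K (W j)} (hm : Encodes P G m)
    {requested : Fin K → Tag N} {x : Fin K → V} (hx : G.Realizes requested x)
    {r : Modif K (W j)}
    (hl : ForEach (modifyStep P s σ j m requested) ⟨m.val, fun _ => false, fun _ => false⟩ r)
    (he : ∀ Y, r.error1 Y = false ∧ r.error2 Y = false) :
    Encodes P G ⟨r.codeword, requested⟩ := by
  have hinv := hl.invariant (Inv := fun S r => (∀ Y, r.error1 Y = false ∧ r.error2 Y = false) →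
    Encodes P G ⟨r.codeword, S.piecewise m.tagvec requested⟩) ?_ fun _ => by simpa using hm
  · simpa using hinv he
  intro X S r r' hX hs ih he'
  obtain ⟨he₁, he₂, hstep⟩ := encodes_of_modifyStep (τ := S.piecewise m.tagvec requested) hG h hs
    (hx X) (he' X).1 (he' X).2
  have hr := ih (he₁ ▸ he₂ ▸ he')
  rw [Finset.piecewise_insert] at hr
  simpa only [← Finset.piecewise_eq_of_notMem S m.tagvec requested hX, Function.update_eq_self]
    using hstep hr

/-! ### Effects of the transitions of a server -/

/-- The effect of a transition of server `s` on its own state and on the messages to the other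
servers. The clock only adopts entries of the timestamps of versions. -/
structure ServerEffect (P : Params N K F V W C) (G : Versions N K V) {s : Fin N}
    (a b : Loc K V W C I s) : Prop where
  correct : ServerCorrect P G b.st
  out : ∀ j m, m ∈ b.out j → m ∈ a.out j ∨ MsgCorrect P G m
  vc_le : a.st.vc ≤ b.st.vc
  vc_source : ∀ p, b.st.vc p ≤ a.st.vc p ∨ ∃ X t v, G X t v ∧ b.st.vc p ≤ t.ts p
  used : a.used ⊆ b.used

/-- The effect of a transition that is not caused by a client. -/
structure Effect (P : Params N K F V W C) (G : Versions N K V) {s : Fin N}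
    (a b : Loc K V W C I s) : Prop extends ServerEffect P G a b where
  client : ∀ c, ClientEffect G a b c

/-- The effect of a transition that keeps the clock and that no client can notice. -/
structure Quiet (P : Params N K F V W C) (G : Versions N K V) {s : Fin N}
    (a b : Loc K V W C I s) : Prop extends ServerEffect P G a b where
  vc : b.st.vc = a.st.vc
  resps : b.resps = a.resps
  reads : ∀ c, b.st.readsOf c = a.st.readsOf c

variable {a a₁ b : Loc K V W C I s} {c : C}

theorem ServerEffect.of_correct (h : ServerCorrect P G b.st) (hout : b.out = a.out)
    (hvc : b.st.vc = a.st.vc) (hused : a.used ⊆ b.used) : ServerEffect P G a b where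
  correct := h
  out _ _ hm := Or.inl (hout ▸ hm)
  vc_le := hvc.ge
  vc_source p := Or.inl (congrFun hvc p).le
  used := hused

theorem ServerEffect.send (h : ServerEffect P G a b) {Q : Fin N → Prop} {m : Msg K V W C I s}
    (hm : MsgCorrect P G m) : ServerEffect P G a (b.send Q m) :=
  { h with
    out := fun j _ hm' => (Loc.mem_out_send hm').elim (h.out j _) fun heq => Or.inr (heq ▸ hm) }

theorem ServerEffect.clearReads (h : ServerEffect P G a b) (D : Set (ReadEntry K W C I)) (v : V) :
    ServerEffect P G a (b.clearReads D v) :=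
  { h with correct := h.correct.shrinkReads Set.sdiff_subset }

theorem Quiet.of_correct (h : ServerCorrect P G b.st) (hout : b.out = a.out)
    (hvc : b.st.vc = a.st.vc) (hused : a.used ⊆ b.used) (hresps : b.resps = a.resps)
    (hreads : ∀ c, b.st.readsOf c = a.st.readsOf c) : Quiet P G a b :=
  ⟨.of_correct h hout hvc hused, hvc, hresps, hreads⟩

theorem Quiet.refl (h : ServerCorrect P G a.st) : Quiet P G a a :=
  .of_correct h rfl rfl subset_rfl rfl fun _ => rfl

theorem Quiet.trans (h₁ : Quiet P G a a₁) (h₂ : Quiet P G a₁ b) : Quiet P G a b where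
  correct := h₂.correct
  out j m hm := (h₂.out j m hm).elim (h₁.out j m) Or.inr
  vc_le := h₁.vc_le.trans h₂.vc_le
  vc_source := h₂.vc ▸ h₁.vc_source
  used := h₁.used.trans h₂.used
  vc := h₂.vc.trans h₁.vc
  resps := h₂.resps.trans h₁.resps
  reads c := (h₂.reads c).trans (h₁.reads c)

theorem Quiet.send (h : Quiet P G a b) {Q : Fin N → Prop} {m : Msg K V W C I s}
    (hm : MsgCorrect P G m) : Quiet P G a (b.send Q m) :=
  { h with toServerEffect := h.toServerEffect.send hm }

theorem Quiet.effect (h : Quiet P G a b) : Effect P G a b :=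
  { h with client := fun c => .silent (h.reads c) (congrFun h.resps c) }

theorem ForEach.quiet {step : Fin K → Loc K V W C I s → Loc K V W C I s → Prop}
    (hstep : ∀ X x y, ServerCorrect P G x.st → step X x y → Quiet P G x y)
    (hl : ForEach step a b) (h : ServerCorrect P G a.st) : Quiet P G a b :=
  hl.invariant (Inv := fun _ x => Quiet P G a x)
    (fun X _ x y _ hs hx => hx.trans (hstep X x y hx.correct hs)) (.refl h)

theorem Quiet.trans_effect (h₁ : Quiet P G a a₁) (h₂ : Effect P G a₁ b) : Effect P G a b where
  correct := h₂.correct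
  out j m hm := (h₂.out j m hm).elim (h₁.out j m) Or.inr
  vc_le := h₁.vc_le.trans h₂.vc_le
  vc_source := h₁.vc ▸ h₂.vc_source
  used := h₁.used.trans h₂.used
  client c := by
    rcases h₂.client c with ⟨hreads, hresps⟩ | ⟨before, after, hid, hobj, hresps⟩ |
      ⟨before, after, hv, hresps⟩
    · exact .silent (hreads.trans (h₁.reads c)) (hresps.trans (congrFun h₁.resps c))
    · exact .update (h₁.reads c ▸ before) after hid hobj (hresps.trans (congrFun h₁.resps c))
    · exact .answer (h₁.reads c ▸ before) after hv (h₁.resps ▸ hresps)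

/-! ### Answers to pending reads -/

theorem ServerCorrect.serverEffect_deliver (h : ServerCorrect P G a.st)
    {e : ReadEntry K W C I} (he : e ∈ a.st.readL) {v : V} (hv : G e.obj (e.tagvec e.obj) v) :
    ServerEffect P G a (a.deliver e v) := by
  have hremoved := h.shrinkReads (R := a.st.readL \ {e}) Set.sdiff_subset
  unfold Loc.deliver
  cases hc : e.client with
  | none =>
    refine .of_correct (hremoved.addToL hv (h.reads e he).tag_le ?_) rfl rfl subset_rfl
    rintro f ⟨hf, hne⟩ hfc hobj
    exact absurd (h.reads_unique f hf e he (hfc.trans hc.symm) fun _ => hobj) hne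
  | some c => exact .of_correct hremoved rfl rfl subset_rfl

theorem ServerCorrect.effect_deliver (h : ServerCorrect P G a.st) {e : ReadEntry K W C I}
    (he : e ∈ a.st.readL) {v : V} (hv : G e.obj (e.tagvec e.obj) v) :
    Effect P G a (a.deliver e v) := by
  have hserver := h.serverEffect_deliver he hv
  refine { hserver with client := fun c => ?_ }
  have hreads : (a.deliver e v).st.readsOf c = a.st.readsOf c \ {e} := by
    refine ServerState.readsOf_sdiff ?_
    unfold Loc.deliver
    cases e.client <;> rfl
  by_cases hc : e.client = some c
  · have hsingle := h.readsOf_eq_singleton he hc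
    refine .answer hsingle (by rw [hreads, hsingle, Set.sdiff_self])
      ⟨_, hv, (h.reads e he).tag_le.trans hserver.vc_le⟩ ?_
    simp [Loc.deliver, hc, Loc.reply]
  · refine .silent (by rw [hreads, Set.sdiff_singleton_eq_self fun he' => hc he'.2]) ?_
    unfold Loc.deliver
    cases hd : e.client with
    | none => rfl
    | some d => exact Function.update_of_ne (fun hcd => hc (hd.trans (congrArg some hcd.symm))) _ _

theorem ServerCorrect.effect_setSyms (h : ServerCorrect P G a.st) {e : ReadEntry K W C I}
    (he : e ∈ a.st.readL) {w : ∀ i : Fin N, Option (W i)} {x : Fin K → V}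
    (hx : G.Realizes e.tagvec x) (hw : P.IsPartialCodeword x w) :
    Effect P G a
      { a with st := { a.st with readL := (a.st.readL \ {e}) ∪ {{ e with syms := w }} } } := by
  have hremoved := h.shrinkReads (R := a.st.readL \ {e}) Set.sdiff_subset
  have hcorrect := hremoved.addRead (e := { e with syms := w })
    { h.reads e he with syms := ⟨x, hx, hw⟩ } fun f hf hc ho =>
      hf.2 (h.reads_unique f hf.1 e he hc fun hn => ho (hc ▸ hn))
  refine { ServerEffect.of_correct hcorrect rfl rfl subset_rfl with client := fun c => ?_ }
  let σ : ServerState K V W C I s := { a.st with readL := a.st.readL \ {e} }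
  have hreads : σ.readsOf c = a.st.readsOf c \ {e} := ServerState.readsOf_sdiff rfl
  by_cases hc : e.client = some c
  · have hsingle := h.readsOf_eq_singleton he hc
    refine .update (e' := { e with syms := w }) hsingle ?_ rfl rfl rfl
    rw [ServerState.readsOf_addRead (σ := σ) (e := { e with syms := w }) rfl hc, hreads, hsingle,
      Set.sdiff_self, Set.empty_union]
  · refine .silent ?_ rfl
    rw [ServerState.readsOf_addRead_of_ne (σ := σ) (e := { e with syms := w }) rfl hc, hreads,
      Set.sdiff_singleton_eq_self fun he' => hc he'.2]

/-! ### Requests -/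

theorem onWrite_serverEffect {o : I} {v : V} (h : ServerCorrect P G a.st)
    (hb : onWrite P s c o X v a b) (hG : G X ⟨b.st.vc, P.cid c⟩ v) : ServerEffect P G a b := by
  subst hb
  have hle : a.st.vc ≤ Function.update a.st.vc s (a.st.vc s + 1) :=
    le_update_self_iff.2 (Nat.le_succ _)
  refine ServerEffect.clearReads ?_ _ _
  refine ServerEffect.send ?_ hG
  refine ⟨?_, fun _ _ => Or.inl, hle, fun _ => Or.inr ⟨X, _, v, hG, le_rfl⟩, subset_rfl⟩
  refine ServerCorrect.addToL (h.advance hle subset_rfl) hG le_rfl fun _ _ _ _ htag => ?_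
  have hcurrent : (a.st.M.tagvec X).ts s ≤ a.st.vc s := h.symbol_le X s
  have hnew : (a.st.M.tagvec X).ts s = a.st.vc s + 1 := by
    simpa using congrArg (fun t : Tag N => t.ts s) htag
  omega

theorem onWrite_clientEffect {o : I} {v : V} {c' : C} (h : ServerCorrect P G a.st)
    (hb : onWrite P s c o X v a b) (hG : G X ⟨b.st.vc, P.cid c⟩ v) (hc : c' ≠ c) :
    ClientEffect G a b c' := by
  subst hb
  refine ClientEffect.clearReads (h.readsOf_subsingleton c') ?_ ?_ ?_
  · rfl
  · exact Function.update_of_ne hc _ _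
  · rintro e ⟨-, rfl⟩
    exact ⟨_, hG, le_rfl⟩

theorem onWrite_requestEffect {o : I} {v : V} (hb : onWrite P s c o X v a b)
    (hno : a.st.readsOf c = ∅) : RequestEffect G a b c o (.write X v) := by
  subst hb
  refine .answer (r := .writeAck o) ?_ (.write (lt_update_self_iff.2 (Nat.lt_succ_self _))) ?_
  · exact (ServerState.readsOf_sdiff rfl).trans
      (Set.subset_empty_iff.1 (Set.sdiff_subset.trans hno.subset))
  · have hother : (fun e : ReadEntry K W C I => Resp.readReturn e.opid v) ''
        (a.st.readsOf c ∩ {e | e.client ≠ none ∧ e.obj = X}) = ∅ := by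
      rw [hno, Set.empty_inter, Set.image_empty]
    exact (Loc.resps_clearReads ..).trans
      ((congrArg₂ (· ∪ ·) (Function.update_self c _ a.resps) hother).trans (Set.union_empty _))

theorem onRead_cases {o : I} (h : ServerCorrect P G a.st) (hb : onRead P s c o X a b) :
    (∃ v, G.VisibleAt a.st.vc X v ∧ b = a.reply c (.readReturn o v)) ∨
      b = Loc.send
        { a with st := { a.st with
            readL := a.st.readL ∪ {⟨some c, o, X, a.st.M.tagvec, onlyAt s a.st.M.val⟩} } }
        (fun _ => True) (.valInq (some c) o X a.st.M.tagvec) := by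
  obtain ⟨q, hq, hb⟩ := hb
  rcases ite_prop_iff_or.1 hb with ⟨-, p, rfl, rfl⟩ | ⟨-, hb⟩
  · exact Or.inl ⟨p.2, ⟨p.1, h.list hq.1⟩, rfl⟩
  rcases ite_prop_iff_or.1 hb with ⟨-, v, hv, rfl⟩ | ⟨-, rfl⟩
  · obtain ⟨x, hx, hxG⟩ := h.symbol
    have hvx : v = x X := hv.eq (hx ▸ P.isPartialCodeword_onlyAt s x)
    exact Or.inl ⟨v, ⟨_, hvx ▸ hxG X, h.symbol_le X⟩, rfl⟩
  · exact Or.inr rfl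

theorem onRead_serverEffect {o : I} (h : ServerCorrect P G a.st) (hb : onRead P s c o X a b)
    (hc : P.home c = s) (hno : a.st.readsOf c = ∅) : ServerEffect P G a b := by
  rcases onRead_cases h hb with ⟨v, -, rfl⟩ | rfl
  · exact .of_correct h rfl rfl subset_rfl
  · refine ServerEffect.send ?_ trivial
    refine .of_correct (h.addRead ?_ fun f hf hfc _ => ?_) rfl rfl subset_rfl
    · exact h.readCorrect_onlyAt o (fun d hd => Option.some.inj hd ▸ hc) fun hn => nomatch hn
    · exact hno.subset (⟨hf, hfc⟩ : f ∈ a.st.readsOf c)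

theorem onRead_clientEffect {o : I} {c' : C} (h : ServerCorrect P G a.st)
    (hb : onRead P s c o X a b) (hc : c' ≠ c) : ClientEffect G a b c' := by
  rcases onRead_cases h hb with ⟨v, -, rfl⟩ | rfl
  · exact .silent rfl (Function.update_of_ne hc _ _)
  · exact .silent (ServerState.readsOf_addRead_of_ne rfl fun h => hc (Option.some.inj h).symm) rfl

theorem onRead_requestEffect {o : I} (h : ServerCorrect P G a.st) (hb : onRead P s c o X a b)
    (hno : a.st.readsOf c = ∅) : RequestEffect G a b c o (.read X) := by
  rcases onRead_cases h hb with ⟨v, hv, rfl⟩ | rfl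
  · exact .answer hno (.read hv) (Function.update_self c _ a.resps)
  · refine RequestEffect.wait (e := ⟨some c, o, X, a.st.M.tagvec, onlyAt s a.st.M.val⟩) ?_ rfl rfl
    exact (ServerState.readsOf_addRead rfl rfl).trans (by rw [hno, Set.empty_union])

/-! ### Messages -/

theorem onValInq_quiet (hG : IsVersioning G) {cl : Option C} {o : I} {wanted : Fin K → Tag N}
    (h : ServerCorrect P G a.st) (hb : onValInq P s j cl o X wanted a b) : Quiet P G a b := by
  rcases ite_prop_iff_or.1 hb with ⟨-, v, hv, rfl⟩ | ⟨-, r, hl, rfl⟩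
  · exact (Quiet.refl h).send (h.list hv).1
  · exact (Quiet.refl h).send (encodes_of_responseLoop hG h hl)

theorem onValResp_effect {cl : Option C} {o : I} {v : V} {requested : Fin K → Tag N}
    (h : ServerCorrect P G a.st) (hv : G X (requested X) v)
    (hb : onValResp s X v cl o requested a b) : Effect P G a b := by
  rcases ite_prop_iff_or.1 hb with ⟨-, w, hw, hb⟩ | ⟨-, rfl⟩
  · obtain rfl : b = a.deliver ⟨cl, o, X, requested, w⟩ v := by cases cl <;> exact hb
    exact h.effect_deliver hw hv
  · exact (Quiet.refl h).effect

theorem onValRespEncoded_effect (hG : IsVersioning G) {m : Symbol N K (W j)} {cl : Option C}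
    {o : I} {requested : Fin K → Tag N} (h : ServerCorrect P G a.st) (hm : Encodes P G m)
    (hb : onValRespEncoded P s j m cl o X requested a b) : Effect P G a b := by
  have hflags (f₁ f₂ : Fin K → Bool) :
      Quiet P G a { a with st := { a.st with error1 := f₁, error2 := f₂ } } :=
    .of_correct (h.congr rfl rfl rfl rfl rfl) rfl rfl subset_rfl rfl fun _ => rfl
  rcases ite_prop_iff_or.1 hb with ⟨-, w, hw, r, hl, hb⟩ | ⟨-, rfl⟩
  swap
  · exact (hflags _ _).effect
  rcases ite_prop_iff_or.1 hb with ⟨hno, hb⟩ | ⟨-, rfl⟩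
  swap
  · exact (hflags _ _).effect
  have hquiet := hflags r.error1 r.error2
  refine hquiet.trans_effect ?_
  obtain ⟨x, hx, hsyms⟩ := (h.reads _ hw).syms
  obtain ⟨y, hy, hyG⟩ := encodes_of_modifyLoop hG h hm hx hl hno
  obtain rfl : y = x := hG.realizes_unique hyG hx
  have hsyms' : P.IsPartialCodeword y (Function.update w j (some r.codeword)) :=
    (show r.codeword = P.Φ j y from hy) ▸ hsyms.update
  rcases ite_prop_iff_or.1 hb with ⟨-, T, v, hv, hb⟩ | ⟨-, rfl⟩
  · have hvG : G X (requested X) v := hv.eq hsyms' ▸ hx X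
    have hremoved : {e ∈ a.st.readL | ¬ (e.client = cl ∧ e.opid = o ∧ e.obj = X ∧
        e.tagvec = requested)} = a.st.readL \ {⟨cl, o, X, requested, w⟩} := by
      ext e
      refine and_congr_right fun he => not_congr ⟨fun ⟨hec, _, heX, _⟩ =>
        h.reads_unique e he _ hw hec fun _ => heX, ?_⟩
      rintro rfl
      exact ⟨rfl, rfl, rfl, rfl⟩
    dsimp only at hb
    rw [hremoved] at hb
    have hdeliver := hquiet.correct.effect_deliver hw hvG
    cases cl with
    | none =>
      have htag := ((h.reads _ hw).localhost rfl).2.1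
      dsimp only at htag
      rw [← htag] at hb
      exact hb ▸ hdeliver
    | some c => exact hb ▸ hdeliver
  · exact hquiet.correct.effect_setSyms hw hx hsyms'

theorem onMsg_effect (hG : IsVersioning G) {m : Msg K V W C I j} (h : ServerCorrect P G a.st)
    (hm : MsgCorrect P G m) (hb : onMsg P s j m a b) : Effect P G a b := by
  cases m with
  | app X v t =>
    obtain rfl := hb
    refine Quiet.effect (.of_correct ?_ rfl rfl subset_rfl rfl fun _ => rfl)
    refine { h with inQueue := ?_, reads := fun e he => { h.reads e he with } }
    rintro j' X' v' t' (hq | hq)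
    · exact h.inQueue hq
    · obtain ⟨rfl, rfl, rfl, rfl⟩ := hq
      exact hm
  | del X t =>
    obtain rfl := hb
    exact Quiet.effect (.of_correct (h.congr rfl rfl rfl rfl rfl) rfl rfl subset_rfl rfl
      fun _ => rfl)
  | valInq cl o X wanted => exact (onValInq_quiet hG h hb).effect
  | valResp X v cl o requested => exact onValResp_effect h hm hb
  | valRespEncoded m cl o X requested => exact onValRespEncoded_effect hG h hm hb

/-! ### Internal actions -/

theorem applyInQueue_effect (h : ServerCorrect P G a.st) (hb : applyInQueue s a b) :
    Effect P G a b := by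
  obtain ⟨j, X, v, t, hq, -, hb⟩ := hb
  rcases ite_prop_iff_or.1 hb with ⟨⟨ht, hj⟩, rfl⟩ | ⟨-, rfl⟩
  swap
  · exact (Quiet.refl h).effect
  have hGt : G X t v := h.inQueue hq
  have hle : a.st.vc ≤ Function.update a.st.vc j (t.ts j) := le_update_self_iff.2 (by omega)
  have htle : t.ts ≤ Function.update a.st.vc j (t.ts j) := le_update_iff.2 ⟨le_rfl, ht⟩
  constructor
  · refine ServerEffect.clearReads ?_ _ _
    refine ⟨?_, fun _ _ => Or.inl, hle, fun p => ?_, subset_rfl⟩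
    · refine ServerCorrect.addToL (h.advance hle Set.sdiff_subset) hGt htle fun _ _ _ _ htag => ?_
      have hcurrent : (a.st.M.tagvec X).ts j ≤ a.st.vc j := h.symbol_le X j
      have hnew : a.st.M.tagvec X = t := htag
      rw [hnew] at hcurrent
      omega
    · by_cases hp : p = j
      · subst hp
        exact Or.inr ⟨X, t, v, hGt, (Function.update_self ..).le⟩
      · exact Or.inl (Function.update_of_ne hp ..).le
  · intro c
    refine ClientEffect.clearReads (h.readsOf_subsingleton c) ?_ ?_ ?_
    · rfl
    · rfl
    · rintro e ⟨rfl, -⟩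
      exact ⟨t, hGt, htle⟩

theorem encodeStored_quiet (hG : IsVersioning G) (h : ServerCorrect P G a.st)
    (hb : encodeStored P s X a b) : Quiet P G a b := by
  obtain ⟨q, -, hb⟩ := hb
  rcases ite_prop_iff_or.1 hb with ⟨⟨hst, -⟩, p, -, hb⟩ | ⟨-, rfl⟩
  swap
  · exact .refl h
  rcases ite_prop_iff_or.1 hb with ⟨-, u, v, hu, hv, rfl⟩ | ⟨hmissing, hb⟩
  · have hsymbol : Encodes P G ⟨P.Γ s X a.st.M.val u v, Function.update a.st.M.tagvec X p.1⟩ :=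
      Encodes.reencode (t := a.st.M.tagvec X) (by simpa using h.symbol) hG (h.list hu).1
        (h.list hv).1
    have hset := h.setSymbol hv hsymbol fun e he hc hX =>
      ((h.reads e he).localhost hc).2.2 u (hX ▸ hu)
    refine Quiet.send ?_ trivial
    exact .of_correct (hset.congr rfl rfl rfl rfl rfl) rfl rfl subset_rfl rfl fun _ => rfl
  rcases ite_prop_iff_or.1 hb with ⟨-, rfl⟩ | ⟨hnone, o, -, rfl⟩
  · exact .refl h
  · have hread := h.readCorrect_onlyAt (cl := none) o (fun _ hn => nomatch hn)
      fun _ => ⟨hst, fun v hv => hmissing ⟨v, hv⟩⟩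
    refine Quiet.send ?_ trivial
    refine .of_correct (h.addRead hread ?_) rfl rfl Set.subset_union_left rfl
      fun c => ServerState.readsOf_addRead_of_ne rfl (Option.some_ne_none c).symm
    rintro f hf hfc hobj
    obtain rfl : f.obj = X := hobj rfl
    exact hnone ⟨f, hf, hfc, rfl, ((h.reads f hf).localhost hfc).2.1⟩

theorem encodeNotStored_quiet (h : ServerCorrect P G a.st) (hb : encodeNotStored P s X a b) :
    Quiet P G a b := by
  obtain ⟨q, -, hb⟩ := hb
  rcases ite_prop_iff_or.1 hb with ⟨⟨hst, -⟩, t, ht, rfl⟩ | ⟨-, rfl⟩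
  swap
  · exact .refl h
  obtain ⟨v, hv⟩ := ht.1.2.1
  have hsymbol : Encodes P G ⟨a.st.M.val, Function.update a.st.M.tagvec X t⟩ :=
    Encodes.retag (t := a.st.M.tagvec X) (by simpa using h.symbol) hst (h.list hv).1
  have hset := h.setSymbol hv hsymbol fun e he hc hX => hst (hX ▸ ((h.reads e he).localhost hc).1)
  refine Quiet.send ?_ trivial
  exact .of_correct (hset.congr rfl rfl rfl rfl rfl) rfl rfl subset_rfl rfl fun _ => rfl

theorem encoding_quiet (hG : IsVersioning G) (h : ServerCorrect P G a.st)
    (hb : encoding P s a b) : Quiet P G a b := by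
  obtain ⟨a₁, h₁, h₂⟩ := hb
  have hstored := ForEach.quiet (fun X _ _ => encodeStored_quiet (X := X) hG) h₁ h
  exact hstored.trans (ForEach.quiet (fun X _ _ => encodeNotStored_quiet (X := X)) h₂
    hstored.correct)

theorem collectStep_quiet (h : ServerCorrect P G a.st) (hb : collectStep P s X a b) :
    Quiet P G a b := by
  obtain ⟨q, tm, -, -, hb⟩ := hb
  have hcollected (D : Set (Tag N × V)) : Quiet P G a
      { a with st := { a.st with
          tmax := Function.update a.st.tmax X tm
          L := Function.update a.st.L X (a.st.L X \ D) } } := by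
    have hlist := h.shrinkList (L' := Function.update a.st.L X (a.st.L X \ D))
      (update_le_self_iff.2 Set.sdiff_subset)
    exact .of_correct (hlist.congr rfl rfl rfl rfl rfl) rfl rfl subset_rfl rfl fun _ => rfl
  rcases ite_prop_iff_or.1 hb with ⟨-, u, -, rfl⟩ | ⟨-, rfl⟩
  exacts [(hcollected _).send trivial, hcollected _]

theorem garbageCollection_quiet (h : ServerCorrect P G a.st) (hb : garbageCollection P s a b) :
    Quiet P G a b :=
  ForEach.quiet (fun X _ _ => collectStep_quiet (X := X)) hb h

end Transitions

section Views

variable {K : ℕ} {V : Type uV} {N : ℕ} {W : Fin N → Type uW} {C : Type uC} {I : Type uI}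

/-! ### The life cycle of an operation -/

/-- The places of the system where the operation of a given client can be: its pending operation,
the requests that it has sent, the pending reads of its server, and the responses to it. -/
structure ClientView {N : ℕ} (K : ℕ) (V : Type uV) (W : Fin N → Type uW) (C : Type uC)
    (I : Type uI) where
  pending : Option (I × Op K V)
  reqs : Set (I × Op K V)
  reads : Set (ReadEntry K W C I)
  resps : Set (Resp V I)

namespace ClientView

/-- The client has no pending operation. -/
abbrev idle : ClientView K V W C I := ⟨none, ∅, ∅, ∅⟩

/-- The request of the client is in transit to its server. -/
abbrev requested (o : I) (op : Op K V) : ClientView K V W C I := ⟨some (o, op), {(o, op)}, ∅, ∅⟩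

/-- The server has received the read of the client and has not yet answered it. -/
abbrev reading (e : ReadEntry K W C I) : ClientView K V W C I :=
  ⟨some (e.opid, .read e.obj), ∅, {e}, ∅⟩

/-- The response is in transit to the client. -/
abbrev answered (o : I) (op : Op K V) (r : Resp V I) : ClientView K V W C I :=
  ⟨some (o, op), ∅, ∅, {r}⟩

/-- The operation of the client is in at most one place. -/
inductive Valid : ClientView K V W C I → Prop
  | idle : Valid .idle
  | requested {o : I} {op : Op K V} : Valid (.requested o op)
  | reading {e : ReadEntry K W C I} : Valid (.reading e)
  | answered {o : I} {op : Op K V} {r : Resp V I} (h : r.Answers o op) : Valid (.answered o op r)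

variable {x : ClientView K V W C I}

theorem Valid.eq_idle (h : x.Valid) (hp : x.pending = none) : x = .idle := by
  cases h with
  | idle => rfl
  | _ => cases hp

theorem Valid.eq_requested (h : x.Valid) {o : I} {op : Op K V} (hq : (o, op) ∈ x.reqs) :
    x = .requested o op := by
  cases h with
  | requested =>
    obtain ⟨rfl, rfl⟩ := Prod.mk.inj hq
    rfl
  | _ => exact hq.elim

theorem Valid.eq_reading (h : x.Valid) {e : ReadEntry K W C I} (he : e ∈ x.reads) :
    x = .reading e := by
  cases h with
  | reading =>
    obtain rfl : e = _ := he
    rfl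
  | _ => exact he.elim

theorem Valid.exists_eq_answered (h : x.Valid) {r : Resp V I} (hr : r ∈ x.resps) :
    ∃ o op, r.Answers o op ∧ x = .answered o op r := by
  cases h with
  | answered ha =>
    obtain rfl : r = _ := hr
    exact ⟨_, _, ha, rfl⟩
  | _ => exact hr.elim

end ClientView

theorem RespCorrect.answers {G : Versions N K V} {T U : Fin N → ℕ} {o : I} {op : Op K V}
    {r : Resp V I} (h : RespCorrect G T U o op r) : r.Answers o op := by
  cases h with
  | write => rfl
  | read => exact ⟨_, rfl⟩

/-- A step in the life cycle of an operation while the clock of its server moves from `T` to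
`U`. -/
inductive ClientStep (G : Versions N K V) (T U : Fin N → ℕ) :
    ClientView K V W C I → ClientView K V W C I → Prop
  | refl (x : ClientView K V W C I) : ClientStep G T U x x
  | invoke {o : I} {op : Op K V} : ClientStep G T U .idle (.requested o op)
  | wait {e : ReadEntry K W C I} :
      ClientStep G T U (.requested e.opid (.read e.obj)) (.reading e)
  | update {e e' : ReadEntry K W C I} (opid : e'.opid = e.opid) (obj : e'.obj = e.obj) :
      ClientStep G T U (.reading e) (.reading e')
  | answerRequest {o : I} {op : Op K V} {r : Resp V I} (h : RespCorrect G T U o op r) :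
      ClientStep G T U (.requested o op) (.answered o op r)
  | answerRead {e : ReadEntry K W C I} {r : Resp V I}
      (h : RespCorrect G T U e.opid (.read e.obj) r) :
      ClientStep G T U (.reading e) (.answered e.opid (.read e.obj) r)
  | complete {o : I} {op : Op K V} {r : Resp V I} (h : r.Answers o op) :
      ClientStep G T U (.answered o op r) .idle

namespace ClientStep

variable {G : Versions N K V} {T U : Fin N → ℕ} {x y : ClientView K V W C I} {o : I} {op : Op K V}
  {r : Resp V I}

theorem valid (h : ClientStep G T U x y) (hx : x.Valid) : y.Valid := by
  cases h with
  | refl => exact hx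
  | invoke => exact .requested
  | wait => exact .reading
  | update => exact .reading
  | answerRequest h => exact .answered h.answers
  | answerRead h => exact .answered h.answers
  | complete => exact .idle

theorem mem_resps_or_pending_eq_none (h : ClientStep G T U x y) (hr : r ∈ x.resps) :
    r ∈ y.resps ∨ y.pending = none := by
  cases h with
  | refl => exact .inl hr
  | complete => exact .inr rfl
  | _ => exact hr.elim

theorem pending_or_exists_answers (h : ClientStep G T U x y) (hp : x.pending = some (o, op)) :
    y.pending = some (o, op) ∨ ∃ r ∈ x.resps, r.Answers o op := by
  cases h with
  | invoke => cases hp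
  | update opid obj => exact .inl (by simpa only [opid, obj] using hp)
  | complete h =>
    obtain ⟨rfl, rfl⟩ := Prod.mk.inj (Option.some.inj hp)
    exact .inr ⟨_, rfl, h⟩
  | _ => exact .inl hp

theorem respCorrect (h : ClientStep G T U x y) (hr : r ∈ y.resps) (hnew : r ∉ x.resps)
    (hp : y.pending = some (o, op)) : RespCorrect G T U o op r := by
  cases h with
  | refl => exact absurd hr hnew
  | answerRequest h | answerRead h =>
    obtain ⟨rfl, rfl⟩ := Prod.mk.inj (Option.some.inj hp)
    obtain rfl : r = _ := hr
    exact h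
  | _ => exact hr.elim

end ClientStep

theorem Config.put_vc_le {γ : Config K V W C I} {s : Fin N} {b : Loc K V W C I s}
    (h : (γ.srv s).vc ≤ b.st.vc) (p : Fin N) : (γ.srv p).vc ≤ ((γ.put s b).srv p).vc :=
  (Function.forall_update_iff γ.srv fun p σ => (γ.srv p).vc ≤ σ.vc).2 ⟨h, fun _ _ => le_rfl⟩ p

end Views

section System

variable {N K : ℕ} {F : Type uF} {V : Type uV} {W : Fin N → Type uW} {C : Type uC} {I : Type uI}
  [Field F] [AddCommGroup V] [Module F V] [∀ i, AddCommGroup (W i)] [∀ i, Module F (W i)]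
  {P : Params N K F V W C} {G G' : Versions N K V} {γ γ' : Config K V W C I}

/-! ### The invariant of the system -/

/-- The part of the state of the system that concerns the operation of client `c`. -/
def Config.clientView (P : Params N K F V W C) (γ : Config K V W C I) (c : C) :
    ClientView K V W C I :=
  ⟨γ.pending c, γ.reqs c, (γ.srv (P.home c)).readsOf c, γ.resps c⟩

/-- The number of writes that each server has received from clients. -/
def Config.clock (γ : Config K V W C I) (p : Fin N) : ℕ :=
  (γ.srv p).vc p

/-- The states of the servers and the messages between them agree with the versions `G`, and the
vector clocks and the timestamps of the versions only count writes that have been received. -/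
structure ServersCorrect (P : Params N K F V W C) (G : Versions N K V) (γ : Config K V W C I) :
    Prop where
  versioning : IsVersioning G
  server : ∀ s, ServerCorrect P G (γ.srv s)
  chan : ∀ i j, ∀ m ∈ γ.chan i j, MsgCorrect P G m
  vc_le : ∀ s, (γ.srv s).vc ≤ γ.clock
  version_le : ∀ X t v, G X t v → t.ts ≤ γ.clock

/-- The invariant of the system. -/
structure Correct (P : Params N K F V W C) (G : Versions N K V) (γ : Config K V W C I) :
    Prop extends ServersCorrect P G γ where
  client : ∀ c, (γ.clientView P c).Valid
  used : ∀ c q, γ.pending c = some q → q.1 ∈ γ.used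

/-- The effect of a transition of the system on clocks and operations. -/
structure StepEffect (P : Params N K F V W C) (G : Versions N K V) (γ : Config K V W C I)
    (α : Action N K V C I) (γ' : Config K V W C I) : Prop where
  vc_le : ∀ s, (γ.srv s).vc ≤ (γ'.srv s).vc
  used : γ.used ⊆ γ'.used
  client : ∀ c, ClientStep G (γ.srv (P.home c)).vc (γ'.srv (P.home c)).vc
    (γ.clientView P c) (γ'.clientView P c)
  pending : ∀ c o op, γ'.pending c = some (o, op) → γ.pending c = some (o, op) ∨
    α = .invoke c o op ∧ o ∉ γ.used ∧ o ∈ γ'.used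

theorem Correct.of_stepEffect (h : Correct P G γ) {α : Action N K V C I}
    (hγ' : ServersCorrect P G' γ') (he : StepEffect P G' γ α γ') : Correct P G' γ' where
  toServersCorrect := hγ'
  client c := (he.client c).valid (h.client c)
  used c q hq := (he.pending c q.1 q.2 hq).elim (fun hp => he.used (h.used c q hp)) fun hn => hn.2.2

/-! ### Transitions of a server in the system -/

section Put

variable {s : Fin N} {b : Loc K V W C I s} {c : C}

theorem ServersCorrect.put (h : ServersCorrect P G γ) (hG' : IsVersioning G') (hle : G ≤ G')
    (hnew : ∀ X t v, G' X t v → G X t v ∨ t.ts ≤ (γ.put s b).clock)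
    (hb : ServerEffect P G' (γ.view s) b) : ServersCorrect P G' (γ.put s b) := by
  have hclock : γ.clock ≤ (γ.put s b).clock := fun p => Config.put_vc_le hb.vc_le p p
  have hversion (X t v) (hv : G' X t v) : t.ts ≤ (γ.put s b).clock :=
    (hnew X t v hv).elim (fun hv => (h.version_le X t v hv).trans hclock) id
  constructor
  · exact hG'
  · exact (Function.forall_update_iff γ.srv fun _ σ => ServerCorrect P G' σ).2
      ⟨hb.correct, fun p _ => (h.server p).mono hle⟩
  · refine (Function.forall_update_iff γ.chan fun _ out => ∀ j, ∀ m ∈ out j, MsgCorrect P G' m).2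
      ⟨fun j m hm => ?_, fun i _ j m hm => (h.chan i j m hm).mono hle⟩
    exact (hb.out j m hm).elim (fun hm => (h.chan s j m hm).mono hle) id
  · refine (Function.forall_update_iff γ.srv fun _ σ => σ.vc ≤ (γ.put s b).clock).2
      ⟨fun p => ?_, fun p _ => (h.vc_le p).trans hclock⟩
    rcases hb.vc_source p with hp | ⟨X, t, v, hv, hp⟩
    exacts [hp.trans ((h.vc_le s).trans hclock p), hp.trans (hversion X t v hv p)]
  · exact hversion

theorem Config.clientView_put_home {b : Loc K V W C I (P.home c)} :
    (γ.put (P.home c) b).clientView P c =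
      { γ.clientView P c with reads := b.st.readsOf c, resps := b.resps c } := by
  simp [Config.clientView, Config.put]

theorem Config.clientView_put_of_ne (hc : P.home c ≠ s) :
    (γ.put s b).clientView P c = { γ.clientView P c with resps := b.resps c } := by
  simp [Config.clientView, Config.put, hc]

theorem ClientEffect.clientStep (hs : ServerCorrect P G (γ.srv s))
    (hc : (γ.clientView P c).Valid) (h : ClientEffect G (γ.view s) b c) :
    ClientStep G (γ.srv (P.home c)).vc ((γ.put s b).srv (P.home c)).vc
      (γ.clientView P c) ((γ.put s b).clientView P c) := by
  by_cases hhome : P.home c = s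
  swap
  · have hempty : (γ.view s).st.readsOf c = ∅ := hs.readsOf_eq_empty hhome
    rw [Config.clientView_put_of_ne hhome]
    cases h with
    | silent _ resps => exact resps ▸ .refl _
    | update before | answer before => simp [hempty] at before
  subst hhome
  rw [Config.clientView_put_home]
  cases h with
  | silent reads resps => exact reads ▸ resps ▸ .refl _
  | update before after opid obj resps =>
    rw [after, show b.resps c = (γ.clientView P c).resps from resps,
      hc.eq_reading (before.ge rfl)]
    rw [show (⟨some (_, .read _), ∅, {_}, ∅⟩ : ClientView K V W C I) = .reading _ by
      rw [ClientView.reading, opid, obj]]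
    exact .update opid obj
  | answer before after visible resps =>
    rw [after, show b.resps c = (γ.clientView P c).resps ∪ _ from resps,
      hc.eq_reading (before.ge rfl), Set.empty_union]
    refine .answerRead (.read ?_)
    simpa [Config.put] using visible

theorem RequestEffect.clientStep {b : Loc K V W C I (P.home c)} {o : I} {op : Op K V}
    (hc : γ.clientView P c = { ClientView.requested o op with reqs := ∅ })
    (h : RequestEffect G (γ.view (P.home c)) b c o op) :
    ClientStep G (γ.srv (P.home c)).vc ((γ.put (P.home c) b).srv (P.home c)).vc
      (.requested o op) ((γ.put (P.home c) b).clientView P c) := by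
  rw [Config.clientView_put_home]
  cases h with
  | answer reads correct resps =>
    rw [reads, show b.resps c = (γ.clientView P c).resps ∪ _ from resps, hc, Set.empty_union]
    refine .answerRequest ?_
    simp only [Config.put, Function.update_self]
    exact correct
  | wait reads opid resps =>
    subst opid
    rw [reads, show b.resps c = (γ.clientView P c).resps from resps, hc]
    exact .wait

theorem Correct.put_effect (h : Correct P G γ) {α : Action N K V C I}
    (hb : Effect P G (γ.view s) b) :
    ServersCorrect P G (γ.put s b) ∧ StepEffect P G γ α (γ.put s b) where
  left := h.toServersCorrect.put h.versioning le_rfl (fun _ _ _ => .inl) hb.toServerEffect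
  right :=
    { vc_le := Config.put_vc_le hb.vc_le
      used := hb.used
      client := fun c => (hb.client c).clientStep (h.server s) (h.client c)
      pending := fun _ _ _ => .inl }

end Put

/-! ### Transitions of the system -/

theorem Correct.step_invoke (h : Correct P G γ) {c : C} {o : I} {op : Op K V}
    (hs : Step P γ (.invoke c o op) γ') :
    ServersCorrect P G γ' ∧ StepEffect P G γ (.invoke c o op) γ' := by
  obtain ⟨-, hp, ho, rfl⟩ := hs
  have hidle : γ.clientView P c = .idle := (h.client c).eq_idle hp
  obtain ⟨-, hreqs, hreads, hresps⟩ := ClientView.mk.inj hidle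
  refine ⟨{ h with }, fun _ => le_rfl, Set.subset_union_left, fun c' => ?_,
    fun c' o' op' hp' => ?_⟩ <;> obtain rfl | hc := eq_or_ne c' c
  · rw [hidle]
    simpa [Config.clientView, hreqs, hreads, hresps] using ClientStep.invoke
  · simpa [Config.clientView, hc] using ClientStep.refl _
  · obtain ⟨rfl, rfl⟩ : o = o' ∧ op = op' := by simpa using hp'
    exact .inr ⟨rfl, ho, .inr rfl⟩
  · exact .inl (by simpa [hc] using hp')

theorem Correct.step_respond (h : Correct P G γ) {c : C} {r : Resp V I}
    (hs : Step P γ (.respond c r) γ') :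
    ServersCorrect P G γ' ∧ StepEffect P G γ (.respond c r) γ' := by
  obtain ⟨-, hr, rfl⟩ := hs
  obtain ⟨o, op, ha, hanswered⟩ := (h.client c).exists_eq_answered hr
  obtain ⟨hp, hreqs, hreads, hresps⟩ := ClientView.mk.inj hanswered
  rw [if_pos ⟨o, op, hp, ha⟩]
  refine ⟨{ h with }, fun _ => le_rfl, subset_rfl, fun c' => ?_, fun c' o' op' hp' => ?_⟩ <;>
    obtain rfl | hc := eq_or_ne c' c
  · rw [hanswered]
    simpa [Config.clientView, hreqs, hreads, hresps] using ClientStep.complete ha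
  · simpa [Config.clientView, hc] using ClientStep.refl _
  · simp at hp'
  · exact .inl (by simpa [hc] using hp')

theorem Correct.step_receive (h : Correct P G γ) {i s : Fin N} (hs : Step P γ (.receive i s) γ') :
    ServersCorrect P G γ' ∧ StepEffect P G γ (.receive i s) γ' := by
  obtain ⟨-, his, m, rest, b, hm, hb, rfl⟩ := hs
  set γ₁ : Config K V W C I :=
    { γ with chan := Function.update γ.chan i (Function.update (γ.chan i) s rest) } with hγ₁
  have hview : γ.view s = γ₁.view s := by
    simp [hγ₁, Config.view, Function.update_of_ne his.symm]
  have hchan : ∀ i' j, ∀ m' ∈ γ₁.chan i' j, MsgCorrect P G m' := by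
    refine (Function.forall_update_iff γ.chan fun _ out => ∀ j, ∀ m' ∈ out j, MsgCorrect P G m').2
      ⟨(Function.forall_update_iff (γ.chan i) fun _ l => ∀ m' ∈ l, MsgCorrect P G m').2
        ⟨fun m' hm' => ?_, fun j _ => h.chan i j⟩, fun i' _ => h.chan i'⟩
    exact h.chan i s m' (hm ▸ List.mem_cons_of_mem m hm')
  have h₁ : Correct P G γ₁ := { h with chan := hchan }
  have heffect : Effect P G (γ₁.view s) b :=
    onMsg_effect h.versioning (h.server s) (h.chan i s m (hm ▸ List.mem_cons_self)) (hview ▸ hb)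
  obtain ⟨hservers, hstep⟩ := h₁.put_effect (α := .receive i s) heffect
  exact ⟨hservers, { hstep with }⟩

/-- Add a version to the versions `G`. -/
def Versions.insert (G : Versions N K V) (X : Fin K) (t : Tag N) (v : V) : Versions N K V :=
  fun Y u w => G Y u w ∨ Y = X ∧ u = t ∧ w = v

theorem IsVersioning.insert (hG : IsVersioning G) {X : Fin K} {t : Tag N} {v : V}
    (ht : ∀ w, ¬ G X t w) : IsVersioning (G.insert X t v) where
  zero Y := .inl (hG.zero Y)
  unique := by
    rintro Y u w w' (hw | ⟨hY, hu, hw⟩) (hw' | ⟨hY', hu', hw'⟩)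
    · exact hG.unique hw hw'
    · exact absurd (hY' ▸ hu' ▸ hw) (ht w)
    · exact absurd (hY ▸ hu ▸ hw') (ht w')
    · exact hw.trans hw'.symm

/-- The versions after the action `α` with outcome `γ'`: the receipt of a write request creates a
version. -/
def nextVersions (P : Params N K F V W C) (G : Versions N K V) (γ' : Config K V W C I) :
    Action N K V C I → Versions N K V
  | .request c _ (.write X v) => G.insert X ⟨(γ'.srv (P.home c)).vc, P.cid c⟩ v
  | _ => G

section Request

variable {c : C} {o : I} {op : Op K V}

/-- Remove a request of client `c` from the requests in transit. -/
def Config.takeRequest (γ : Config K V W C I) (c : C) (q : I × Op K V) : Config K V W C I :=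
  { γ with reqs := Function.update γ.reqs c (γ.reqs c \ {q}) }

theorem Correct.put_requestEffect (h : Correct P G γ) (hreq : (o, op) ∈ γ.reqs c)
    {b : Loc K V W C I (P.home c)} (hG' : IsVersioning G') (hle : G ≤ G')
    (hnew : ∀ X t v, G' X t v → G X t v ∨ t.ts ≤ (γ.put (P.home c) b).clock)
    (hb : ServerEffect P G' (γ.view (P.home c)) b)
    (hothers : ∀ c' ≠ c, ClientEffect G' (γ.view (P.home c)) b c')
    (hclient : RequestEffect G' (γ.view (P.home c)) b c o op) :
    ServersCorrect P G' ((γ.takeRequest c (o, op)).put (P.home c) b) ∧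
      StepEffect P G' γ (.request c o op) ((γ.takeRequest c (o, op)).put (P.home c) b) := by
  have hrequested : γ.clientView P c = .requested o op := (h.client c).eq_requested hreq
  have hself : (γ.takeRequest c (o, op)).clientView P c =
      { ClientView.requested o op with reqs := ∅ } := by
    obtain ⟨hp, hreqs, hreads, hresps⟩ := ClientView.mk.inj hrequested
    simp [Config.takeRequest, Config.clientView, hp, hreqs, hreads, hresps]
  have hother (c' : C) (hc : c' ≠ c) :
      (γ.takeRequest c (o, op)).clientView P c' = γ.clientView P c' := by
    simp [Config.takeRequest, Config.clientView, hc]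
  refine ⟨ServersCorrect.put { h with } hG' hle hnew hb,
    Config.put_vc_le hb.vc_le, hb.used, fun c' => ?_, fun _ _ _ => .inl⟩
  obtain rfl | hc := eq_or_ne c' c
  · rw [hrequested]
    exact hclient.clientStep hself
  · rw [← hother c' hc]
    exact ClientEffect.clientStep (γ := γ.takeRequest c (o, op)) ((h.server _).mono hle)
      (hother c' hc ▸ h.client c') (hothers c' hc)

theorem Correct.step_write (h : Correct P G γ) {X : Fin K} {v : V}
    (hs : Step P γ (.request c o (.write X v)) γ') :
    ServersCorrect P (G.insert X ⟨(γ'.srv (P.home c)).vc, P.cid c⟩ v) γ' ∧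
      StepEffect P (G.insert X ⟨(γ'.srv (P.home c)).vc, P.cid c⟩ v) γ
        (.request c o (.write X v)) γ' := by
  obtain ⟨-, hreq, b, hb, rfl⟩ := hs
  have hvc : b.st.vc = Function.update (γ.srv (P.home c)).vc (P.home c) (γ.clock (P.home c) + 1) :=
    hb ▸ rfl
  have hno : (γ.view (P.home c)).st.readsOf c = ∅ :=
    congrArg ClientView.reads ((h.client c).eq_requested hreq)
  simp only [Config.put, Function.update_self]
  set t : Tag N := ⟨b.st.vc, P.cid c⟩ with ht
  have hfresh (w : V) : ¬ G X t w := fun hw => by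
    simpa [ht, hvc] using h.version_le X t w hw (P.home c)
  have hle : G ≤ G.insert X t v := fun _ _ _ => .inl
  have hserver := (h.server (P.home c)).mono hle
  have hnew : G.insert X t v X t v := .inr ⟨rfl, rfl, rfl⟩
  have hclock : t.ts ≤ (γ.put (P.home c) b).clock := fun p => by
    obtain rfl | hp := eq_or_ne p (P.home c)
    · simp [ht, Config.clock, Config.put]
    · simpa [ht, hvc, Config.clock, Config.put, hp] using h.vc_le (P.home c) p
  refine h.put_requestEffect hreq (h.versioning.insert hfresh) hle ?_
    (onWrite_serverEffect hserver hb hnew) (fun _ hc => onWrite_clientEffect hserver hb hnew hc)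
    (onWrite_requestEffect hb hno)
  rintro Y u w (hw | ⟨-, rfl, -⟩)
  exacts [.inl hw, .inr hclock]

theorem Correct.step_read (h : Correct P G γ) {X : Fin K}
    (hs : Step P γ (.request c o (.read X)) γ') :
    ServersCorrect P G γ' ∧ StepEffect P G γ (.request c o (.read X)) γ' := by
  obtain ⟨-, hreq, b, hb, rfl⟩ := hs
  have hno : (γ.view (P.home c)).st.readsOf c = ∅ :=
    congrArg ClientView.reads ((h.client c).eq_requested hreq)
  have hserver := h.server (P.home c)
  exact h.put_requestEffect hreq h.versioning le_rfl (fun _ _ _ => .inl)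
    (onRead_serverEffect hserver hb rfl hno) (fun _ hc => onRead_clientEffect hserver hb hc)
    (onRead_requestEffect hserver hb hno)

end Request

theorem Correct.step (h : Correct P G γ) {α : Action N K V C I} (hs : Step P γ α γ') :
    ServersCorrect P (nextVersions P G γ' α) γ' ∧
      StepEffect P (nextVersions P G γ' α) γ α γ' := by
  cases α with
  | invoke c o op => exact h.step_invoke hs
  | request c o op =>
    cases op with
    | write X v => exact h.step_write hs
    | read X => exact h.step_read hs
  | receive i s => exact h.step_receive hs
  | applyInQueue s =>
    obtain ⟨-, b, hb, rfl⟩ := hs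
    exact h.put_effect (applyInQueue_effect (h.server s) hb)
  | encoding s =>
    obtain ⟨-, b, hb, rfl⟩ := hs
    exact h.put_effect (encoding_quiet h.versioning (h.server s) hb).effect
  | garbageCollection s =>
    obtain ⟨-, b, hb, rfl⟩ := hs
    exact h.put_effect (garbageCollection_quiet (h.server s) hb).effect
  | respond c r => exact h.step_respond hs
  | haltServer s =>
    cases hs
    exact ⟨{ h with }, fun _ => le_rfl, subset_rfl, fun _ => .refl _, fun _ _ _ => .inl⟩
  | haltClient c =>
    cases hs
    exact ⟨{ h with }, fun _ => le_rfl, subset_rfl, fun _ => .refl _, fun _ _ _ => .inl⟩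

end System

section Executions

variable {N K : ℕ} {F : Type uF} {V : Type uV} {W : Fin N → Type uW} {C : Type uC} {I : Type uI}

theorem Resp.Answers.opid_eq {o o' : I} {op op' : Op K V} {r : Resp V I} (h : r.Answers o op)
    (h' : r.Answers o' op') : o = o' := by
  cases op <;> cases op' <;> simp only [Resp.Answers] at h h' <;> grind

variable [Field F] [AddCommGroup V] [Module F V] [∀ i, AddCommGroup (W i)] [∀ i, Module F (W i)]
  {P : Params N K F V W C}

/-! ### Executions -/

theorem nextVersions_cases {G : Versions N K V} {γ' : Config K V W C I} {α : Action N K V C I}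
    {X : Fin K} {t : Tag N} {v : V} (h : nextVersions P G γ' α X t v) :
    G X t v ∨ ∃ c o, α = .request c o (.write X v) ∧ t.ts = (γ'.srv (P.home c)).vc := by
  cases α with
  | request c o op =>
    cases op with
    | write Y w =>
      obtain h | ⟨rfl, rfl, rfl⟩ := h
      exacts [.inl h, .inr ⟨c, o, rfl, rfl⟩]
    | read Y => exact .inl h
  | _ => exact .inl h

/-- The versions that exist at point `n` of an execution. -/
def Execution.versions (β : Execution P I) : ℕ → Versions N K V
  | 0 => fun _ t v => t = 0 ∧ v = 0
  | n + 1 => nextVersions P (β.versions n) (β.state (n + 1)) (β.act n)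

theorem Correct.initial :
    Correct P (fun _ t v => t = 0 ∧ v = 0) (Config.initial : Config K V W C I) where
  versioning := ⟨fun _ => ⟨rfl, rfl⟩, fun h h' => h.2.trans h'.2.symm⟩
  server := .initial P fun _ => ⟨rfl, rfl⟩
  chan _ _ _ hm := (List.not_mem_nil hm).elim
  vc_le _ _ := le_rfl
  version_le := by
    rintro _ _ _ ⟨rfl, -⟩ p
    exact le_rfl
  client c := by simpa [Config.clientView, Config.initial, ServerState.initial,
    ServerState.readsOf] using ClientView.Valid.idle
  used _ _ hq := Option.some_ne_none _ hq.symm |>.elim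

namespace Execution

theorem lt_len_of_succ_le {β : Execution P I} {n : ℕ} (h : ((n + 1 : ℕ) : ℕ∞) ≤ β.len) :
    (n : ℕ∞) < β.len :=
  (Nat.cast_lt.2 n.lt_succ_self).trans_le h

theorem le_len_of_le {β : Execution P I} {m n : ℕ} (hmn : m ≤ n) (h : (n : ℕ∞) ≤ β.len) :
    (m : ℕ∞) ≤ β.len :=
  (Nat.cast_le.2 hmn).trans h

theorem correct (β : Execution P I) {n : ℕ} (hn : (n : ℕ∞) ≤ β.len) :
    Correct P (β.versions n) (β.state n) := by
  induction n with
  | zero => exact β.init_eq ▸ .initial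
  | succ n ih =>
    have hlt := lt_len_of_succ_le hn
    obtain ⟨hservers, heffect⟩ := (ih hlt.le).step (β.step n hlt)
    exact (ih hlt.le).of_stepEffect hservers heffect

theorem stepEffect (β : Execution P I) {n : ℕ} (hn : (n : ℕ∞) < β.len) :
    StepEffect P (β.versions (n + 1)) (β.state n) (β.act n) (β.state (n + 1)) :=
  ((β.correct hn.le).step (β.step n hn)).2

theorem monotoneOn_of_step_le {α : Type*} [Preorder α] (β : Execution P I) {f : ℕ → α}
    (hf : ∀ n : ℕ, (n : ℕ∞) < β.len → f n ≤ f (n + 1)) :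
    MonotoneOn f {n | (n : ℕ∞) ≤ β.len} :=
  monotoneOn_of_le_succ ((Set.ordConnected_Iic (a := β.len)).preimage_mono Nat.mono_cast)
    fun n _ _ hn => hf n (lt_len_of_succ_le hn)

theorem monotoneOn_vc (β : Execution P I) (s : Fin N) :
    MonotoneOn (fun n => ((β.state n).srv s).vc) {n | (n : ℕ∞) ≤ β.len} :=
  β.monotoneOn_of_step_le fun _ hn => (β.stepEffect hn).vc_le s

theorem monotoneOn_used (β : Execution P I) :
    MonotoneOn (fun n => (β.state n).used) {n | (n : ℕ∞) ≤ β.len} :=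
  β.monotoneOn_of_step_le fun _ hn => (β.stepEffect hn).used

variable {β : Execution P I} {m n : ℕ} {c : C} {o : I} {op : Op K V}

theorem exists_invoke_of_pending (hn : (n : ℕ∞) ≤ β.len)
    (h : (β.state n).pending c = some (o, op)) : ∃ i < n, β.act i = .invoke c o op := by
  induction n with
  | zero =>
    rw [β.init_eq] at h
    cases h
  | succ n ih =>
    have hlt := lt_len_of_succ_le hn
    obtain h | ⟨h, -⟩ := (β.stepEffect hlt).pending c o op h
    · obtain ⟨i, hi, hact⟩ := ih hlt.le h
      exact ⟨i, hi.trans n.lt_succ_self, hact⟩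
    · exact ⟨n, n.lt_succ_self, h⟩

theorem pending_of_invoke (hn : (n : ℕ∞) < β.len) (h : β.act n = .invoke c o op) :
    (β.state n).pending c = none ∧ (β.state (n + 1)).pending c = some (o, op) := by
  obtain ⟨-, hp, -, hstate⟩ := h ▸ β.step n hn
  rw [hstate]
  exact ⟨hp, Function.update_self (β := fun _ => Option (I × Op K V)) c _ _⟩

theorem used_of_invoke (hn : (n : ℕ∞) < β.len) (h : β.act n = .invoke c o op) :
    o ∉ (β.state n).used ∧ o ∈ (β.state (n + 1)).used := by
  obtain ⟨-, -, ho, hstate⟩ := h ▸ β.step n hn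
  exact ⟨ho, hstate ▸ .inr rfl⟩

theorem invoke_unique (hm : (m : ℕ∞) < β.len) (hn : (n : ℕ∞) < β.len) {c' : C} {op' : Op K V}
    (h : β.act m = .invoke c o op) (h' : β.act n = .invoke c' o op') : m = n := by
  wlog hmn : m ≤ n generalizing m n c c' op op'
  · exact (this hn hm h' h (Nat.le_of_not_le hmn)).symm
  refine hmn.eq_or_lt.resolve_right fun hlt => (used_of_invoke hn h').1 ?_
  exact β.monotoneOn_used (le_len_of_le hlt hn.le) hn.le hlt (used_of_invoke hm h).2

theorem mem_resps_of_pending (hmn : m ≤ n) (hn : (n : ℕ∞) ≤ β.len) {r : Resp V I}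
    (hr : r ∈ (β.state m).resps c) (ha : r.Answers o op)
    (hp : (β.state n).pending c = some (o, op)) : r ∈ (β.state n).resps c := by
  have hm := β.correct (le_len_of_le hmn hn)
  obtain ⟨o', op', ha', hanswered⟩ := (hm.client c).exists_eq_answered hr
  obtain rfl := ha.opid_eq ha'
  have hused : o ∈ (β.state m).used := hm.used c _ (congrArg ClientView.pending hanswered)
  induction n, hmn using Nat.le_induction with
  | base => exact hr
  | succ n hmn ih =>
    have hlt := lt_len_of_succ_le hn
    have hused' := β.monotoneOn_used (le_len_of_le hmn hlt.le) hlt.le hmn hused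
    have hp' : (β.state n).pending c = some (o, op) :=
      ((β.stepEffect hlt).pending c o op hp).resolve_right fun h => h.2.1 hused'
    have hstep := (β.stepEffect hlt).client c
    exact (hstep.mem_resps_or_pending_eq_none (ih hlt.le hp')).resolve_right fun h =>
      Option.some_ne_none _ (hp.symm.trans h)

end Execution

/-! ### Responses and timestamps of invocations -/

variable {β : Execution P I} {π : Invocation β} {m n : ℕ}

theorem Invocation.ResponseAt.idx_lt_and_pending (h : π.ResponseAt n) (hn : (n : ℕ∞) ≤ β.len) :
    π.idx < n ∧ (β.state n).pending π.client = some (π.opid, π.op) := by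
  obtain ⟨r, hr, ha⟩ := h
  obtain ⟨o, op, ha', hanswered⟩ := ((β.correct hn).client π.client).exists_eq_answered hr
  obtain rfl := ha.opid_eq ha'
  have hp : (β.state n).pending π.client = some (π.opid, op) :=
    congrArg ClientView.pending hanswered
  obtain ⟨i, hi, hact⟩ := Execution.exists_invoke_of_pending hn hp
  obtain rfl : i = π.idx :=
    Execution.invoke_unique ((Nat.cast_lt.2 hi).trans_le hn) π.idx_lt hact π.act_eq
  obtain rfl : op = π.op := (Action.invoke.inj (hact.symm.trans π.act_eq)).2.2
  exact ⟨hi, hp⟩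

/-- `n` is the first point at which a response to `π` has been sent. -/
def Invocation.FirstResponse (π : Invocation β) (n : ℕ) : Prop :=
  (n : ℕ∞) ≤ β.len ∧ π.ResponseAt n ∧ ∀ m < n, ¬ π.ResponseAt m

theorem Invocation.FirstResponse.unique (hm : π.FirstResponse m) (hn : π.FirstResponse n) :
    m = n :=
  le_antisymm (not_lt.1 fun h => hm.2.2 n h hn.2.1) (not_lt.1 fun h => hn.2.2 m h hm.2.1)

theorem Invocation.exists_firstResponse (hn : (n : ℕ∞) ≤ β.len) (h : π.ResponseAt n) :
    ∃ m ≤ n, π.FirstResponse m := by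
  have hex : ∃ n, π.ResponseAt n := ⟨n, h⟩
  have hle := Nat.find_min' hex h
  exact ⟨Nat.find hex, hle, Execution.le_len_of_le hle hn, Nat.find_spec hex,
    fun m => Nat.find_min hex⟩

theorem Invocation.hasTimestamp_iff {T : Fin N → ℕ} : (Operation.invoked π).HasTimestamp T ↔
    ∃ n, π.FirstResponse n ∧ T = ((β.state n).srv (P.home π.client)).vc := by
  simp only [Operation.HasTimestamp, Invocation.FirstResponse, and_assoc]

theorem Operation.HasTimestamp.unique {π : Operation β} {T T' : Fin N → ℕ}
    (h : π.HasTimestamp T) (h' : π.HasTimestamp T') : T = T' := by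
  cases π with
  | initial X => exact Eq.trans h (Eq.symm h')
  | invoked π =>
    obtain ⟨n, hn, rfl⟩ := Invocation.hasTimestamp_iff.1 h
    obtain ⟨m, hm, rfl⟩ := Invocation.hasTimestamp_iff.1 h'
    rw [hn.unique hm]

theorem Invocation.FirstResponse.respCorrect (h : π.FirstResponse n) {r : Resp V I}
    (hr : r ∈ (β.state n).resps π.client) (ha : r.Answers π.opid π.op) :
    ∃ k, n = k + 1 ∧ π.idx ≤ k ∧
      RespCorrect (β.versions n) ((β.state k).srv (P.home π.client)).vc
        ((β.state n).srv (P.home π.client)).vc π.opid π.op r := by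
  obtain ⟨hn, hres, hmin⟩ := h
  obtain ⟨hidx, hp⟩ := hres.idx_lt_and_pending hn
  obtain ⟨k, rfl⟩ := Nat.exists_eq_add_one_of_ne_zero (Nat.ne_zero_of_lt hidx)
  have hstep := (β.stepEffect (Execution.lt_len_of_succ_le hn)).client π.client
  exact ⟨k, rfl, Nat.lt_succ_iff.1 hidx,
    hstep.respCorrect hr (fun hk => hmin k k.lt_succ_self ⟨r, hk, ha⟩) hp⟩

theorem Execution.exists_firstResponse_of_write {c : C} {o : I} {X : Fin K} {v : V}
    (hn : (n : ℕ∞) < β.len) (hact : β.act n = .request c o (.write X v)) :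
    ∃ π : Invocation β, π.client = c ∧ π.op = .write X v ∧ π.FirstResponse (n + 1) := by
  obtain ⟨-, hreq, b, hb, hstate⟩ := hact ▸ β.step n hn
  have hrequested := ((β.correct hn.le).client c).eq_requested hreq
  obtain ⟨hp, -, hreads, hresps⟩ := ClientView.mk.inj hrequested
  obtain ⟨i, hi, hinv⟩ := Execution.exists_invoke_of_pending hn.le hp
  refine ⟨⟨i, c, o, .write X v, (Nat.cast_lt.2 hi).trans hn, hinv⟩, rfl, rfl,
    Order.add_one_le_of_lt hn, ?_, ?_⟩
  · cases onWrite_requestEffect (G := β.versions n) hb hreads with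
    | answer _ correct resps =>
      rw [Invocation.ResponseAt, hstate]
      exact ⟨_, resps.ge (.inr rfl), correct.answers⟩
  · rintro m hm ⟨r, hr, ha⟩
    exact hresps.le (Execution.mem_resps_of_pending (Nat.lt_succ_iff.1 hm) hn.le hr ha hp)

theorem Execution.exists_write_of_versions (hn : (n : ℕ∞) ≤ β.len) {X : Fin K} {t : Tag N} {v : V}
    (h : β.versions n X t v) : ∃ φ : Operation β, φ.IsWrite X v ∧ φ.HasTimestamp t.ts := by
  induction n with
  | zero =>
    obtain ⟨rfl, rfl⟩ := h
    exact ⟨.initial X, ⟨rfl, rfl⟩, rfl⟩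
  | succ n ih =>
    have hlt := Execution.lt_len_of_succ_le hn
    obtain h | ⟨c, o, hact, ht⟩ := nextVersions_cases h
    · exact ih hlt.le h
    · obtain ⟨π, rfl, hop, hfirst⟩ := Execution.exists_firstResponse_of_write hlt hact
      exact ⟨.invoked π, hop, Invocation.hasTimestamp_iff.2 ⟨n + 1, hfirst, ht⟩⟩

theorem Operation.Returns.exists_write {π : Operation β} {X : Fin K} {v : V} (hv : π.Returns v)
    (hX : π.IsRead X) : ∃ T, π.HasTimestamp T ∧
      ∃ (φ : Operation β) (T' : Fin N → ℕ), φ.IsWrite X v ∧ φ.HasTimestamp T' ∧ T' ≤ T := by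
  obtain _ | π := π
  · exact hX.elim
  obtain ⟨-, n, hn, hp, hact⟩ := hv
  replace hX : π.op = .read X := hX
  obtain ⟨-, hr, -⟩ := hact ▸ β.step n hn
  have ha : (Resp.readReturn π.opid v : Resp V I).Answers π.opid π.op := by
    rw [hX]
    exact ⟨v, rfl⟩
  obtain ⟨m, hmn, hm⟩ := Invocation.exists_firstResponse hn.le ⟨_, hr, ha⟩
  obtain ⟨r, hr', ha'⟩ := hm.2.1
  obtain rfl : r = .readReturn π.opid v := by
    obtain ⟨_, _, -, hanswered⟩ := ((β.correct hn.le).client π.client).exists_eq_answered hr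
    have hresps := congrArg ClientView.resps hanswered
    exact hresps.le (Execution.mem_resps_of_pending hmn hn.le hr' ha' hp)
  obtain ⟨k, -, -, hcorrect⟩ := hm.respCorrect hr' ha'
  rw [hX] at hcorrect
  obtain _ | ⟨t, ht, hle⟩ := hcorrect
  obtain ⟨φ, hφ, hφt⟩ := Execution.exists_write_of_versions hm.1 ht
  exact ⟨_, Invocation.hasTimestamp_iff.2 ⟨m, hm, rfl⟩, φ, t.ts, hφ, hφt, hle⟩

theorem Invocation.exists_firstResponse_of_lt {π₁ π₂ : Invocation β}
    (hc : π₁.client = π₂.client) (hlt : π₁.idx < π₂.idx) : ∃ n ≤ π₂.idx, π₁.FirstResponse n := by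
  by_contra! hno
  have hno' (n : ℕ) (hn : n ≤ π₂.idx) : ¬ π₁.ResponseAt n := fun hr => by
    obtain ⟨m, hm, hm'⟩ :=
      Invocation.exists_firstResponse (Execution.le_len_of_le hn π₂.idx_lt.le) hr
    exact hno m (hm.trans hn) hm'
  have hpending (n : ℕ) (hn : π₁.idx + 1 ≤ n) :
      n ≤ π₂.idx → (β.state n).pending π₁.client = some (π₁.opid, π₁.op) := by
    induction n, hn using Nat.le_induction with
    | base => exact fun _ => (Execution.pending_of_invoke π₁.idx_lt π₁.act_eq).2
    | succ n _ ih =>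
      intro hle
      have hn := Execution.lt_len_of_succ_le (Execution.le_len_of_le hle π₂.idx_lt.le)
      have hstep := (β.stepEffect hn).client π₁.client
      exact (hstep.pending_or_exists_answers (ih (Nat.le_of_succ_le hle))).resolve_right
        (hno' n (Nat.le_of_succ_le hle))
  have hnone := (Execution.pending_of_invoke π₂.idx_lt π₂.act_eq).1
  rw [← hc, hpending π₂.idx hlt le_rfl] at hnone
  cases hnone

end Executions

section Orders

variable {N K : ℕ} {F : Type uF} {V : Type uV} {W : Fin N → Type uW} {C : Type uC} {I : Type uI}
  [Field F] [AddCommGroup V] [Module F V] [∀ i, AddCommGroup (W i)] [∀ i, Module F (W i)]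
  {P : Params N K F V W C} {β : Execution P I} {π π₁ π₂ π₃ φ φ' : Operation β} {X Y : Fin K} {v : V}

/-! ### The timestamp order -/

theorem Operation.IsWrite.not_isRead (h : π.IsWrite X v) : ¬ π.IsRead Y := by
  cases π with
  | initial => exact id
  | invoked π => exact fun h' => nomatch (show π.op = .write X v from h).symm.trans h'

theorem Operation.isWrite_or_isRead (π : Operation β) :
    (∃ X v, π.IsWrite X v) ∨ ∃ X, π.IsRead X := by
  cases π with
  | initial X => exact .inl ⟨X, 0, rfl, rfl⟩
  | invoked π =>
    rcases h : π.op with ⟨X, v⟩ | X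
    exacts [.inl ⟨X, v, h⟩, .inr ⟨X, h⟩]

theorem ProgramOrder.trans (h₁ : ProgramOrder π₁ π₂) (h₂ : ProgramOrder π₂ π₃) :
    ProgramOrder π₁ π₃ := by
  cases π₁ <;> cases π₂ <;> cases π₃ <;> simp only [ProgramOrder] at h₁ h₂ ⊢
  exact ⟨h₁.1.trans h₂.1, h₁.2.trans h₂.2⟩

/-- The timestamp order among the operations with a given timestamp. -/
def TieOrder (π₁ π₂ : Operation β) : Prop :=
  (∃ X, π₂.IsRead X) ∧ ((∃ X v, π₁.IsWrite X v) ∨ ProgramOrder π₁ π₂)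

theorem TieOrder.trans (h₁ : TieOrder π₁ π₂) (h₂ : TieOrder π₂ π₃) : TieOrder π₁ π₃ := by
  obtain ⟨⟨X, hread⟩, h₁⟩ := h₁
  obtain ⟨hread', ⟨Y, v, hwrite⟩ | h₂⟩ := h₂
  · exact absurd hread hwrite.not_isRead
  · exact ⟨hread', h₁.imp id fun h₁ => h₁.trans h₂⟩

theorem timestampOrder_iff : TimestampOrder π₁ π₂ ↔ ∃ T₁, π₁.HasTimestamp T₁ ∧
    ∀ T₂, π₂.HasTimestamp T₂ → T₁ < T₂ ∨ T₁ = T₂ ∧ TieOrder π₁ π₂ := by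
  constructor
  · rintro (⟨T₁, T₂, h₁, h₂, hlt⟩ | ⟨T, h₁, h₂, hw, hr⟩ | ⟨T, h₁, h₂, -, hr, hpo⟩ | ⟨⟨T, h₁⟩, hno⟩)
    · exact ⟨T₁, h₁, fun T₂' h₂' => .inl (h₂.unique h₂' ▸ hlt)⟩
    · exact ⟨T, h₁, fun T₂ h₂' => .inr ⟨h₂.unique h₂', hr, .inl hw⟩⟩
    · exact ⟨T, h₁, fun T₂ h₂' => .inr ⟨h₂.unique h₂', hr, .inr hpo⟩⟩
    · exact ⟨T, h₁, fun T₂ h₂ => absurd ⟨T₂, h₂⟩ hno⟩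
  · rintro ⟨T₁, h₁, h⟩
    by_cases h₂ : ∃ T₂, π₂.HasTimestamp T₂
    swap
    · exact .inr (.inr (.inr ⟨⟨T₁, h₁⟩, h₂⟩))
    obtain ⟨T₂, h₂⟩ := h₂
    obtain hlt | ⟨rfl, hr₂, htie⟩ := h T₂ h₂
    · exact .inl ⟨T₁, T₂, h₁, h₂, hlt⟩
    obtain hw | hr₁ := π₁.isWrite_or_isRead
    · exact .inr (.inl ⟨T₁, h₁, h₂, hw, hr₂⟩)
    obtain ⟨X, v, hw⟩ | hpo := htie
    · exact .inr (.inl ⟨T₁, h₁, h₂, ⟨X, v, hw⟩, hr₂⟩)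
    · exact .inr (.inr (.inl ⟨T₁, h₁, h₂, hr₁, hr₂, hpo⟩))

theorem TimestampOrder.trans (h : TimestampOrder π₁ π₂) (h' : TimestampOrder π₂ π₃) :
    TimestampOrder π₁ π₃ := by
  rw [timestampOrder_iff] at h h' ⊢
  obtain ⟨T₁, h₁, h⟩ := h
  obtain ⟨T₂, h₂, h'⟩ := h'
  refine ⟨T₁, h₁, fun T₃ h₃ => ?_⟩
  obtain hlt | ⟨rfl, htie⟩ := h T₂ h₂ <;> obtain hlt' | ⟨rfl, htie'⟩ := h' T₃ h₃
  exacts [.inl (hlt.trans hlt'), .inl hlt, .inl hlt', .inr ⟨rfl, htie.trans htie'⟩]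

theorem ProgramOrder.timestampOrder (h : ProgramOrder π₁ π₂) : TimestampOrder π₁ π₂ := by
  obtain _ | π₁ := π₁
  · exact h.elim
  obtain _ | π₂ := π₂
  · exact h.elim
  obtain ⟨n₁, hle₁, h₁⟩ := Invocation.exists_firstResponse_of_lt h.1 h.2
  refine timestampOrder_iff.2 ⟨_, Invocation.hasTimestamp_iff.2 ⟨n₁, h₁, rfl⟩, fun T₂ hT₂ => ?_⟩
  obtain ⟨n₂, h₂, rfl⟩ := Invocation.hasTimestamp_iff.1 hT₂
  obtain ⟨r, hr, ha⟩ := h₂.2.1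
  obtain ⟨k, rfl, hk, hcorrect⟩ := h₂.respCorrect hr ha
  rw [← h.1] at hcorrect ⊢
  have hk' : (k : ℕ∞) ≤ β.len := (Execution.lt_len_of_succ_le h₂.1).le
  have hle : ((β.state n₁).srv (P.home π₁.client)).vc ≤ ((β.state k).srv (P.home π₁.client)).vc :=
    β.monotoneOn_vc _ h₁.1 hk' (hle₁.trans hk)
  have hle' := hle.trans (β.monotoneOn_vc (P.home π₁.client) hk' h₂.1 k.le_succ)
  rcases hop : π₂.op with ⟨X, v⟩ | X
  · rw [hop] at hcorrect
    cases hcorrect with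
    | write hlt => exact .inl (hle.trans_lt hlt)
  · exact hle'.lt_or_eq.imp id fun heq => ⟨heq, ⟨X, hop⟩, .inr h⟩

theorem timestampOrder_of_le {T T' : Fin N → ℕ} (hw : φ.IsWrite X v) (hr : π.IsRead Y)
    (hφ : φ.HasTimestamp T') (hπ : π.HasTimestamp T) (hle : T' ≤ T) : TimestampOrder φ π := by
  refine timestampOrder_iff.2 ⟨T', hφ, fun T₂ h₂ => ?_⟩
  obtain rfl := hπ.unique h₂
  exact hle.lt_or_eq.imp id fun heq => ⟨heq, ⟨Y, hr⟩, .inl ⟨X, v, hw⟩⟩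

/-! ### A causal order that extends the timestamp order -/

/-- The position of an operation among those with equal weights: writes come before reads, reads
are ordered by their invocations, and writes in the opposite way. Hence only finitely many writes
of a given weight lie above a given one, and so there is always a last write to read from. -/
def Operation.rank : Operation β → ℤ
  | .initial _ => 0
  | .invoked π => match π.op with
    | .write _ _ => -(π.idx + 1)
    | .read _ => π.idx + 1

/-- The sum of the timestamp of an operation, which increases with the timestamp. Operations
without a timestamp have weight `0`. -/
noncomputable def Operation.weight (π : Operation β) : ℕ :=
  if h : ∃ T, π.HasTimestamp T then ∑ p, h.choose p else 0

/-- The key by which the operations with timestamps are ordered. -/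
noncomputable def Operation.key (π : Operation β) : ℕ ×ₗ ℤ := toLex (π.weight, π.rank)

/-- The extension of the timestamp order that compares the keys of operations with timestamps. -/
def KeyOrder (π₁ π₂ : Operation β) : Prop :=
  (∃ T, π₁.HasTimestamp T) ∧ ((∃ T, π₂.HasTimestamp T) → π₁.key < π₂.key)

theorem Operation.key_lt_key : π₁.key < π₂.key ↔
    π₁.weight < π₂.weight ∨ π₁.weight = π₂.weight ∧ π₁.rank < π₂.rank :=
  Prod.Lex.toLex_lt_toLex

theorem Operation.HasTimestamp.weight_eq {T : Fin N → ℕ} (h : π.HasTimestamp T) :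
    π.weight = ∑ p, T p := by
  have hex : ∃ T, π.HasTimestamp T := ⟨T, h⟩
  rw [Operation.weight, dif_pos hex, hex.choose_spec.unique h]

theorem Operation.IsWrite.rank_nonpos (h : π.IsWrite X v) : π.rank ≤ 0 := by
  cases π with
  | initial => exact le_rfl
  | invoked π =>
    simp only [Operation.rank, show π.op = .write X v from h]
    omega

theorem Operation.IsRead.rank_pos (h : π.IsRead X) : 0 < π.rank := by
  cases π with
  | initial => exact h.elim
  | invoked π =>
    simp only [Operation.rank, show π.op = .read X from h]
    omega

theorem TieOrder.rank_lt (h : TieOrder π₁ π₂) : π₁.rank < π₂.rank := by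
  obtain ⟨⟨Y, hread⟩, h⟩ := h
  obtain ⟨X, v, hwrite⟩ | ⟨X, hread'⟩ := π₁.isWrite_or_isRead
  · exact hwrite.rank_nonpos.trans_lt hread.rank_pos
  have hpo := h.resolve_left fun ⟨_, _, hwrite⟩ => hwrite.not_isRead hread'
  obtain _ | π₁ := π₁
  · exact hread'.elim
  obtain _ | π₂ := π₂
  · exact hread.elim
  have hidx : π₁.idx < π₂.idx := hpo.2
  simp only [Operation.rank, show π₁.op = .read X from hread', show π₂.op = .read Y from hread]
  omega

theorem TimestampOrder.keyOrder (h : TimestampOrder π₁ π₂) : KeyOrder π₁ π₂ := by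
  obtain ⟨T₁, h₁, h⟩ := timestampOrder_iff.1 h
  refine ⟨⟨T₁, h₁⟩, fun ⟨T₂, h₂⟩ => Operation.key_lt_key.2 ?_⟩
  rw [h₁.weight_eq, h₂.weight_eq]
  refine (h T₂ h₂).imp (fun hlt => ?_) fun ⟨heq, htie⟩ => ⟨heq ▸ rfl, htie.rank_lt⟩
  exact Fintype.sum_strictMono hlt

theorem keyOrder_isStrictOrder : IsStrictOrder (Operation β) KeyOrder where
  irrefl _ h := lt_irrefl _ (h.2 h.1)
  trans _ _ _ h₁ h₂ := ⟨h₁.1, fun h => (h₁.2 h₂.1).trans (h₂.2 h)⟩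

theorem timestampOrder_isStrictOrder : IsStrictOrder (Operation β) TimestampOrder where
  irrefl π h := keyOrder_isStrictOrder.irrefl π h.keyOrder
  trans _ _ _ := TimestampOrder.trans

theorem exists_readsFrom {r : Operation β → Operation β → Prop}
    (hr : ∀ π₁ π₂, r π₁ π₂ → KeyOrder π₁ π₂) (hπ : ∃ T, π.HasTimestamp T) (hφ : r φ π)
    (hw : φ.IsWrite X v) : ∃ φ, ReadsFrom r π X v φ := by
  let μ : Operation β → ℕ ×ₗ ℕ := fun φ => toLex (π.weight - φ.weight, (-φ.rank).toNat)
  obtain ⟨φ, ⟨hφ, hw⟩, hmin⟩ := (InvImage.wf μ wellFounded_lt).has_min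
    {φ | r φ π ∧ φ.IsWrite X v} ⟨φ, hφ, hw⟩
  refine ⟨φ, hφ, hw, fun ω hφω hωπ hω => hmin ω ⟨hωπ, hω⟩ (Prod.Lex.toLex_lt_toLex.2 ?_)⟩
  have hkey := Operation.key_lt_key.1 ((hr _ _ hφω).2 (hr _ _ hωπ).1)
  have hkey' := Operation.key_lt_key.1 ((hr _ _ hωπ).2 hπ)
  have hrank := hω.rank_nonpos
  have hrank' := hw.rank_nonpos
  dsimp only
  omega

theorem Operation.Returns.exists_readsFrom (hv : π.Returns v) (hX : π.IsRead X) :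
    ∃ φ, ReadsFrom TimestampOrder π X v φ := by
  obtain ⟨T, hT, φ, T', hw, hφ, hle⟩ := hv.exists_write hX
  exact CausalEC.exists_readsFrom (fun _ _ => TimestampOrder.keyOrder) ⟨T, hT⟩
    (timestampOrder_of_le hw hX hφ hT hle) hw

theorem Invocation.ext_idx {π π' : Invocation β} (h : π.idx = π'.idx) : π = π' := by
  obtain ⟨i, c, o, op, hi, hact⟩ := π
  obtain ⟨i', c', o', op', hi', hact'⟩ := π'
  obtain rfl : i = i' := h
  obtain ⟨rfl, rfl, rfl⟩ := Action.invoke.inj (hact.symm.trans hact')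
  rfl

theorem Operation.IsWrite.eq_of_rank_eq (h : φ.IsWrite X v) (h' : φ'.IsWrite X v)
    (hrank : φ.rank = φ'.rank) : φ = φ' := by
  have hop {π : Invocation β} (h : (Operation.invoked π).IsWrite X v) :
      (Operation.invoked π).rank = -(π.idx + 1) := by
    simp only [Operation.rank, show π.op = .write X v from h]
  obtain Y | π := φ <;> obtain Y' | π' := φ'
  · rw [h.1, h'.1]
  · have : (0 : ℤ) = -(π'.idx + 1) := hrank.trans (hop h')
    omega
  · have : -(π.idx + 1 : ℤ) = 0 := (hop h).symm.trans hrank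
    omega
  · have : -(π.idx + 1 : ℤ) = -(π'.idx + 1) := (hop h).symm.trans (hrank.trans (hop h'))
    rw [Invocation.ext_idx (by omega : π.idx = π'.idx)]

theorem keyOrder_isCausalOrder : IsCausalOrder (KeyOrder (β := β)) where
  isStrictOrder := keyOrder_isStrictOrder
  programOrder _ _ h := h.timestampOrder.keyOrder
  reads π X v hX hv := by
    obtain ⟨T, hT, φ₀, T', hw₀, hφ₀, hle⟩ := hv.exists_write hX
    obtain ⟨φ, hφ⟩ := exists_readsFrom (fun _ _ => id) ⟨T, hT⟩
      (timestampOrder_of_le hw₀ hX hφ₀ hT hle).keyOrder hw₀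
    refine ⟨φ, hφ, fun φ' hφ' => ?_⟩
    obtain hlt | heq | hlt := lt_trichotomy φ.key φ'.key
    · exact absurd hφ'.2.1 (hφ.2.2 φ' ⟨hφ.1.1, fun _ => hlt⟩ hφ'.1)
    · have hrank : φ'.rank = φ.rank := (congrArg (fun x => (ofLex x).2) heq).symm
      exact hφ'.2.1.eq_of_rank_eq hφ.2.1 hrank
    · exact absurd hφ.2.1 (hφ'.2.2 φ ⟨hφ'.1.1, fun _ => hlt⟩ hφ.1)

end Orders

end CausalEC

end

theorem mainTheorem1 {N K : ℕ} {F V C I : Type*} {W : Fin N → Type*}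
    [Field F] [AddCommGroup V] [Module F V] [∀ i, AddCommGroup (W i)] [∀ i, Module F (W i)]
    (P : CausalEC.Params N K F V W C) (β : CausalEC.Execution P I) :
    CausalEC.CausallyConsistent β ∧
    IsStrictOrder (CausalEC.Operation β) CausalEC.TimestampOrder ∧
    (∀ π₁ π₂ : CausalEC.Operation β,
      CausalEC.ProgramOrder π₁ π₂ → CausalEC.TimestampOrder π₁ π₂) ∧
    (∀ (π : CausalEC.Operation β) (X : Fin K) (v : V), π.IsRead X → π.Returns v →
      ∃ φ, CausalEC.ReadsFrom CausalEC.TimestampOrder π X v φ) ∧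
    ∃ r : CausalEC.Operation β → CausalEC.Operation β → Prop,
      (∀ π₁ π₂, CausalEC.TimestampOrder π₁ π₂ → r π₁ π₂) ∧ CausalEC.IsCausalOrder r :=
  ⟨⟨_, CausalEC.keyOrder_isCausalOrder⟩, CausalEC.timestampOrder_isStrictOrder,
    fun _ _ => CausalEC.ProgramOrder.timestampOrder,
    fun _ _ _ hX hv => hv.exists_readsFrom hX,
    CausalEC.KeyOrder, fun _ _ => CausalEC.TimestampOrder.keyOrder, CausalEC.keyOrder_isCausalOrder⟩
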